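/- Let $n$ range over the odd positive integers. For each such $n$ let $m_1(n),\dots,m_n(n)$ be positive real numbers that are unimodal, i.e. for some $j^*$ (which may depend on $n$) $m_1(n)\le\dots\le m_{j^*}(n)\ge m_{j^*+1}(n)\ge\dots\ge m_n(n)$; no symmetry is assumed, and the family is otherwise arbitrary in $n$. Put $z'=\sum_{j=1}^n m_j(n)$, $\pi(j)=m_j(n)/z'$ for $1\le j\le n$, $\pi(0)=\pi(n+1)=0$, and $\theta=1/n$. The Diaconis–Holmes–Neal sampler is the Markov chain on the $2n$ states $(\epsilon,j)$, $\epsilon=\pm1$, $1\le j\le n$, one step of which is performed as follows: from $(\epsilon,j)$ move to $(-\epsilon,j+\epsilon)$ with probability $\min\{1,\pi(j+\epsilon)/\pi(j)\}$ and stay put otherwise; then change the sign of the first coordinate with probability $1-\theta$ and leave it unchanged otherwise. Let $P^z(y,\cdot)$ be the law of the chain after $z$ steps started from the state $y$, let $\tilde\pi(\epsilon,j)=\tfrac12\pi(j)$, and let $\|P-Q\|=\tfrac12\sum_s|P(s)-Q(s)|$. For $c'>0$ write $$D(c')=\limsup_{n\to\infty,\ n\text{ odd}}\ \sup_{y}\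 \sup_{z\ge c'n}\ \|P^z(y,\cdot)-\tilde\pi\| .$$ **Theorem.** For every such family: 1. There is a constant $C>0$, depending only on the family, such that for every $c>0$ there is $\hat c>0$ with $\hat c e^{-c}<1$ (depending only on the family and on $c$) such that for every $c'>0$ $$D(c')\le C\,\bigl(1-\hat c\,e^{-c}\bigr)^{\lfloor c'/c\rfloor}.$$ 2. For all sufficiently large $c$ the factor $C$ is not needed and $\hat c$ can be taken independent of $c$: there are $c_0>0$ and $\hat c>0$, depending only on the family, such that for all $c\ge c_0$ one has $\hat c e^{-c}<1$ and, for every $c'>0$, $$D(c')\le \bigl(1-\hat c\,e^{-c}\bigr)^{\lfloor c'/c\rfloor}.$$ 3. Consequently the sampler mixes in order $n$ steps: for every $\delta>0$ there is $K>0$ such that for all sufficiently large odd $n$, all states $y$ and all $z\ge Kn$, $\|P^z(y,\cdot)-\tilde\pi\|<\delta$. -/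

import Mathlib

open Filter

/-- A finite sequence is unimodal: for some index `jstar` it is nondecreasing up to `jstar` and
nonincreasing from `jstar` on. (The sites `1, …, n` are modelled by `Fin n`.) -/
def IsUnimodal {n : ℕ} (m : Fin n → ℝ) : Prop :=
  ∃ jstar : Fin n, MonotoneOn m (Set.Iic jstar) ∧ AntitoneOn m (Set.Ici jstar)

namespace DHN

/-- The `2 n` states `(ε, j)` with `ε = ±1` and `j` one of the `n` sites. -/
abbrev State (n : ℕ) : Type := ℤˣ × Fin n

/-- The site in `{1, …, n}` represented by an element of `Fin n`. -/
def site {n : ℕ} (j : Fin n) : ℤ := (j : ℤ) + 1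

/-- A function on the sites `1, …, n`, extended by zero to all integers. -/
def zeroExt {n : ℕ} (p : Fin n → ℝ) (k : ℤ) : ℝ :=
  if h : 1 ≤ k ∧ k ≤ n then p ⟨(k - 1).toNat, by omega⟩ else 0

/-- The underlying probabilities `π(j) = m_j / z'` with `z' = ∑ j, m_j`. -/
noncomputable def underlying {n : ℕ} (m : Fin n → ℝ) (j : Fin n) : ℝ :=
  m j / ∑ i, m i

/-- The stationary law `(ε, j) ↦ π(j) / 2`. -/
noncomputable def stationary {n : ℕ} (p : Fin n → ℝ) (s : State n) : ℝ :=
  (1 / 2) * p s.2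

/-- The acceptance probability `min {1, π(j + ε) / π(j)}`, where `π(0) = π(n + 1) = 0`. -/
noncomputable def accept {n : ℕ} (p : Fin n → ℝ) (s : State n) : ℝ :=
  min 1 (zeroExt p (site s.2 + (s.1 : ℤ)) / p s.2)

/-- First half of a step: move from `(ε, j)` to `(-ε, j + ε)` with probability `accept p (ε, j)`,
and stay put otherwise. -/
noncomputable def moveKernel {n : ℕ} (p : Fin n → ℝ) : Matrix (State n) (State n) ℝ :=
  Matrix.of fun s s' =>
    (if s'.1 = -s.1 ∧ site s'.2 = site s.2 + (s.1 : ℤ) then accept p s else 0) +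
      (if s' = s then 1 - accept p s else 0)

/-- Second half of a step: change the sign with probability `1 - θ`, and stay put otherwise. -/
noncomputable def signKernel (n : ℕ) (θ : ℝ) : Matrix (State n) (State n) ℝ :=
  Matrix.of fun s s' =>
    (if s' = (-s.1, s.2) then 1 - θ else 0) + (if s' = s then θ else 0)

/-- The transition matrix of the Diaconis–Holmes–Neal sampler: one step consists of the first
half followed by the second half. -/
noncomputable def kernel {n : ℕ} (θ : ℝ) (p : Fin n → ℝ) : Matrix (State n) (State n) ℝ :=
  moveKernel p * signKernel n θ

/-- The variation distance `(1/2) ∑ s, |P s - Q s|` on a finite set. -/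
noncomputable def variationDist {S : Type*} [Fintype S] (P Q : S → ℝ) : ℝ :=
  (1 / 2) * ∑ s, |P s - Q s|

/-- The variation distance between the law after `z` steps, started at `y`, of the sampler with
`θ = 1/n` and underlying probabilities `m_j / z'`, and the stationary law. -/
noncomputable def distToStationarity {n : ℕ} (m : Fin n → ℝ) (y : State n) (z : ℕ) : ℝ :=
  variationDist (fun s => (kernel (1 / (n : ℝ)) (underlying m) ^ z) y s)
    (stationary (underlying m))

/-- The upper limit, as `n → ∞` through odd integers, of the supremum over all starting states `y`
and all `z ≥ c' n` of the distance to stationarity after `z` steps is at most `B`. -/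
def LimsupDistLE (m : (n : ℕ) → Fin n → ℝ) (c' B : ℝ) : Prop :=
  ∀ ε : ℝ, 0 < ε → ∀ᶠ n : ℕ in atTop, Odd n →
    ∀ (y : State n) (z : ℕ), c' * (n : ℝ) ≤ (z : ℝ) → distToStationarity (m n) y z ≤ B + ε

end DHN

/-! All constants are uniform over unimodal vectors. Let `P` be one step acting on functions: the
Metropolis move composed with the lazy sign flip. Both factors are self-adjoint in L² of the
stationary law, but `P` is not, so its behaviour near 1 and near -1 is examined separately, at scale
`1/n`.

Near 1: a centred solution of `g - P g = w` is at most of order `n` times `w` (`poisson_bound`).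
Flux across each edge controls the odd part of `g`, summing inwards from an end of the interval; and
moves towards the mode are always accepted, so `g` changes little along them. Hence sums of powers
of `P` on centred functions stay `O(n)` (`abs_sum_pow_le`). Near -1: a bounded `g` with `g + P g`
small has small mean absolute value (`mean_abs_le_of_add_step`).

Each step loses energy proportional to `θ` times the squared odd part, so the odd parts along an
orbit are square-summable with total `O(n)`. Up to odd parts, `‖P^s g‖²` equals `⟨g, P^(2s) g⟩`, and
the sum of even powers is half the sum of the powers of `P` and of `-P`. This gives decay in mean
square after `O(n)` steps (`mean_sq_decay`).

Passing to the sup norm by dividing by the least probability would ruin the scale. Instead, an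
omitted flip, of probability `θ`, turns an outgoing state back, after which it travels to the mode
without rejections. Such resets tie the value at every state to values at the mode
(`reset_lower_bound`), and time averages at the mode are close to the stationary mean, already
small. The sup norm therefore contracts by a fixed factor in `O(n)` steps, and iteration gives
geometric decay. -/

namespace DHN

/-! ### The sampler as an operator on functions -/

/-- Real functions of a sign and an integer site. -/
abbrev Obs : Type := ℤˣ → ℤ → ℝ

/-- A unimodal probability vector on the sites `1, …, n`, extended by zero, with a mode at `J`. -/
structure IsProfile (n : ℕ) (p : ℤ → ℝ) (J : ℤ) : Prop where
  pos : ∀ j : ℤ, 1 ≤ j → j ≤ n → 0 < p j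
  zero_left : ∀ j, j ≤ 0 → p j = 0
  zero_right : ∀ j : ℤ, n < j → p j = 0
  sum_eq_one : ∑ j ∈ Finset.Icc 1 (n : ℤ), p j = 1
  one_le : 1 ≤ J
  le_size : J ≤ n
  le_succ : ∀ j, j < J → p j ≤ p (j + 1)
  succ_le : ∀ j, J ≤ j → p (j + 1) ≤ p j

/-- The acceptance probability of the move from `(ε, j)` to `(-ε, j + ε)`. -/
noncomputable def acc (p : ℤ → ℝ) (ε : ℤˣ) (j : ℤ) : ℝ := min 1 (p (j + ε) / p j)

/-- The first half of a step, acting on functions. -/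
noncomputable def moveOp (p : ℤ → ℝ) : Module.End ℝ Obs where
  toFun f ε j := f ε j + acc p ε j * (f (-ε) (j + ε) - f ε j)
  map_add' f g := by ext ε j; simp only [Pi.add_apply]; ring
  map_smul' r f := by ext ε j; simp only [Pi.smul_apply, smul_eq_mul, RingHom.id_apply]; ring

/-- The second half of a step, acting on functions. -/
noncomputable def lazyFlip (θ : ℝ) : Module.End ℝ Obs where
  toFun f ε j := (1 - θ) * f (-ε) j + θ * f ε j
  map_add' f g := by ext ε j; simp only [Pi.add_apply]; ring
  map_smul' r f := by ext ε j; simp only [Pi.smul_apply, smul_eq_mul, RingHom.id_apply]; ring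

/-- A full step of the sampler, acting on functions. -/
noncomputable def stepOp (θ : ℝ) (p : ℤ → ℝ) : Module.End ℝ Obs := moveOp p * lazyFlip θ

/-- Integration against the stationary law. -/
noncomputable def mean (n : ℕ) (p : ℤ → ℝ) : Obs →ₗ[ℝ] ℝ where
  toFun f := ∑ j ∈ Finset.Icc 1 (n : ℤ), p j * ((f 1 j + f (-1) j) / 2)
  map_add' f g := by
    rw [← Finset.sum_add_distrib]
    exact Finset.sum_congr rfl fun j _ => by simp only [Pi.add_apply]; ring
  map_smul' r f := by
    simp only [Pi.smul_apply, smul_eq_mul, RingHom.id_apply, Finset.mul_sum]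
    exact Finset.sum_congr rfl fun j _ => by ring

/-- The part of a function that is odd in the sign, evaluated at the positive sign. -/
noncomputable def oddPart (f : Obs) (j : ℤ) : ℝ := (f 1 j - f (-1) j) / 2

/-- The squared norm of the odd part. -/
noncomputable def oddSq (n : ℕ) (p : ℤ → ℝ) (f : Obs) : ℝ :=
  ∑ j ∈ Finset.Icc 1 (n : ℤ), p j * oddPart f j ^ 2

theorem moveOp_apply (p : ℤ → ℝ) (f : Obs) (ε : ℤˣ) (j : ℤ) :
    moveOp p f ε j = f ε j + acc p ε j * (f (-ε) (j + ε) - f ε j) := rfl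

theorem lazyFlip_apply (θ : ℝ) (f : Obs) (ε : ℤˣ) (j : ℤ) :
    lazyFlip θ f ε j = (1 - θ) * f (-ε) j + θ * f ε j := rfl

theorem stepOp_apply (θ : ℝ) (p : ℤ → ℝ) (f : Obs) :
    stepOp θ p f = moveOp p (lazyFlip θ f) := rfl

theorem mean_apply (n : ℕ) (p : ℤ → ℝ) (f : Obs) :
    mean n p f = ∑ j ∈ Finset.Icc 1 (n : ℤ), p j * ((f 1 j + f (-1) j) / 2) := rfl

/-! ### Reversibility, positivity and energy loss -/

section

variable {n : ℕ} {p : ℤ → ℝ} {J : ℤ}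

theorem IsProfile.nonneg (h : IsProfile n p J) (j : ℤ) : 0 ≤ p j := by
  by_cases h1 : j ≤ 0
  · exact (h.zero_left j h1).ge
  by_cases h2 : (n : ℤ) < j
  · exact (h.zero_right j h2).ge
  · exact (h.pos j (by omega) (by omega)).le

theorem IsProfile.mem_of_ne_zero (h : IsProfile n p J) {j : ℤ} (hj : p j ≠ 0) :
    1 ≤ j ∧ j ≤ n := by
  constructor
  · by_contra h1
    exact hj (h.zero_left j (by omega))
  · by_contra h1
    exact hj (h.zero_right j (by omega))

theorem acc_nonneg (h : IsProfile n p J) (ε : ℤˣ) (j : ℤ) : 0 ≤ acc p ε j :=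
  le_min zero_le_one (div_nonneg (h.nonneg _) (h.nonneg _))

theorem acc_le_one (p : ℤ → ℝ) (ε : ℤˣ) (j : ℤ) : acc p ε j ≤ 1 := min_le_left _ _

/-- Detailed balance: the right side is symmetric in the two sites. It survives `p j = 0` because
division by zero makes the acceptance probability 0 there; states off the interval are thus frozen
by the move. -/
theorem mul_acc (h : IsProfile n p J) (ε : ℤˣ) (j : ℤ) :
    p j * acc p ε j = min (p j) (p (j + ε)) := by
  rcases (h.nonneg j).eq_or_lt with h0 | h0
  · rw [← h0, zero_mul, min_eq_left (h.nonneg _)]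
  · rw [acc, mul_min_of_nonneg _ _ h0.le, mul_one, mul_div_cancel₀ _ h0.ne']

theorem acc_eq_one {ε : ℤˣ} {j : ℤ} (h0 : 0 < p j) (h1 : p j ≤ p (j + ε)) : acc p ε j = 1 :=
  min_eq_left ((one_le_div h0).2 h1)

theorem acc_eq_zero {ε : ℤˣ} {j : ℤ} (h : p j = 0 ∨ p (j + ε) = 0) : acc p ε j = 0 := by
  rcases h with h | h <;> simp [acc, h]

/-- Regroups the stationary sum into the pairs `(1, j)`, `(-1, j + 1)` that the move exchanges. The
range starts at 0 so that the unpaired end states sit with a partner of weight zero. -/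
theorem two_mul_mean (h : IsProfile n p J) (f : Obs) :
    2 * mean n p f =
      ∑ j ∈ Finset.Icc 0 (n : ℤ), (p j * f 1 j + p (j + 1) * f (-1) (j + 1)) := by
  have h1 : ∑ j ∈ Finset.Icc 0 (n : ℤ), p j * f 1 j =
      ∑ j ∈ Finset.Icc 1 (n : ℤ), p j * f 1 j := by
    symm
    apply Finset.sum_subset
    · intro j hj; simp only [Finset.mem_Icc] at hj ⊢; omega
    · intro j hj hj'
      simp only [Finset.mem_Icc] at hj hj'
      rw [h.zero_left j (by omega), zero_mul]
  have h2 : ∑ j ∈ Finset.Icc 0 (n : ℤ), p (j + 1) * f (-1) (j + 1) =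
      ∑ j ∈ Finset.Icc 1 (n : ℤ), p j * f (-1) j := by
    have : Finset.Icc 1 ((n : ℤ) + 1) =
        (Finset.Icc 0 (n : ℤ)).map (addRightEmbedding 1) := by
      rw [Finset.map_add_right_Icc]; simp
    have h3 : ∑ j ∈ Finset.Icc 0 (n : ℤ), p (j + 1) * f (-1) (j + 1) =
        ∑ j ∈ Finset.Icc 1 ((n : ℤ) + 1), p j * f (-1) j := by
      rw [this, Finset.sum_map]; rfl
    rw [h3]
    symm
    apply Finset.sum_subset
    · intro j hj; simp only [Finset.mem_Icc] at hj ⊢; omega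
    · intro j hj hj'
      simp only [Finset.mem_Icc] at hj hj'
      rw [h.zero_right j (by omega), zero_mul]
  rw [Finset.sum_add_distrib, h1, h2, mean_apply, Finset.mul_sum, ← Finset.sum_add_distrib]
  exact Finset.sum_congr rfl fun j _ => by ring

theorem moveOp_edge (h : IsProfile n p J) (u v : Obs) (j : ℤ) :
    p j * (moveOp p u 1 j * v 1 j) + p (j + 1) * (moveOp p u (-1) (j + 1) * v (-1) (j + 1)) =
      p j * (u 1 j * moveOp p v 1 j) +
        p (j + 1) * (u (-1) (j + 1) * moveOp p v (-1) (j + 1)) := by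
  have h1 := mul_acc h 1 j
  have h2 := mul_acc h (-1) (j + 1)
  have e : j + 1 + ((-1 : ℤˣ) : ℤ) = j := by simp
  rw [e, min_comm] at h2
  simp only [moveOp_apply, e, neg_neg, Units.val_one] at h1 ⊢
  linear_combination (u (-1) (j + 1) * v 1 j - u 1 j * v (-1) (j + 1)) * h1 +
    (u 1 j * v (-1) (j + 1) - u (-1) (j + 1) * v 1 j) * h2

theorem moveOp_one (p : ℤ → ℝ) : moveOp p 1 = 1 := by
  ext ε j; simp [moveOp_apply]

theorem lazyFlip_one (θ : ℝ) : lazyFlip θ 1 = 1 := by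
  ext ε j; simp [lazyFlip_apply]

theorem stepOp_one (θ : ℝ) (p : ℤ → ℝ) : stepOp θ p 1 = 1 := by
  rw [stepOp_apply, lazyFlip_one, moveOp_one]

/-- The mass of each pair of communicating states is preserved. -/
theorem moveOp_flux (h : IsProfile n p J) (u : Obs) (j : ℤ) :
    p j * moveOp p u 1 j + p (j + 1) * moveOp p u (-1) (j + 1) =
      p j * u 1 j + p (j + 1) * u (-1) (j + 1) := by
  simpa [moveOp_one] using moveOp_edge h u 1 j

theorem mean_moveOp_mul (h : IsProfile n p J) (u v : Obs) :
    mean n p (moveOp p u * v) = mean n p (u * moveOp p v) := by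
  have : 2 * mean n p (moveOp p u * v) = 2 * mean n p (u * moveOp p v) := by
    rw [two_mul_mean h, two_mul_mean h]
    exact Finset.sum_congr rfl fun j _ => moveOp_edge h u v j
  linarith

theorem mean_moveOp (h : IsProfile n p J) (u : Obs) : mean n p (moveOp p u) = mean n p u := by
  simpa [moveOp_one] using mean_moveOp_mul h u 1

theorem mean_lazyFlip_mul (n : ℕ) (p : ℤ → ℝ) (θ : ℝ) (u v : Obs) :
    mean n p (lazyFlip θ u * v) = mean n p (u * lazyFlip θ v) := by
  rw [mean_apply, mean_apply]
  refine Finset.sum_congr rfl fun j _ => ?_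
  simp only [Pi.mul_apply, lazyFlip_apply, neg_neg]
  ring

theorem mean_lazyFlip (n : ℕ) (p : ℤ → ℝ) (θ : ℝ) (u : Obs) :
    mean n p (lazyFlip θ u) = mean n p u := by
  simpa [lazyFlip_one] using mean_lazyFlip_mul n p θ u 1

theorem mean_stepOp (h : IsProfile n p J) (θ : ℝ) (u : Obs) :
    mean n p (stepOp θ p u) = mean n p u := by
  rw [stepOp_apply, mean_moveOp h, mean_lazyFlip]

theorem mean_mono (h : IsProfile n p J) {f g : Obs}
    (hfg : ∀ ε (j : ℤ), 1 ≤ j → j ≤ n → f ε j ≤ g ε j) : mean n p f ≤ mean n p g := by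
  rw [mean_apply, mean_apply]
  refine Finset.sum_le_sum fun j hj => mul_le_mul_of_nonneg_left ?_ (h.nonneg j)
  rw [Finset.mem_Icc] at hj
  have := hfg 1 j hj.1 hj.2
  have := hfg (-1) j hj.1 hj.2
  linarith

theorem mean_one (h : IsProfile n p J) : mean n p 1 = 1 := by
  rw [mean_apply, ← h.sum_eq_one]
  exact Finset.sum_congr rfl fun j _ => by simp

theorem mean_const (h : IsProfile n p J) (r : ℝ) : mean n p (fun _ _ => r) = r := by
  have : (fun _ _ => r : Obs) = r • 1 := by ext; simp
  rw [this, map_smul, mean_one h, smul_eq_mul, mul_one]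

theorem moveOp_mono (h : IsProfile n p J) {f g : Obs} (hfg : f ≤ g) :
    moveOp p f ≤ moveOp p g := by
  intro ε j
  rw [moveOp_apply, moveOp_apply]
  have h1 := mul_le_mul_of_nonneg_left (hfg (-ε) (j + ε)) (acc_nonneg h ε j)
  have h2 := mul_le_mul_of_nonneg_left (hfg ε j) (sub_nonneg.2 (acc_le_one p ε j))
  linarith

theorem lazyFlip_mono {θ : ℝ} (h0 : 0 ≤ θ) (h1 : θ ≤ 1) {f g : Obs} (hfg : f ≤ g) :
    lazyFlip θ f ≤ lazyFlip θ g := by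
  intro ε j
  rw [lazyFlip_apply, lazyFlip_apply]
  have := mul_le_mul_of_nonneg_left (hfg (-ε) j) (sub_nonneg.2 h1)
  have := mul_le_mul_of_nonneg_left (hfg ε j) h0
  linarith

theorem stepOp_mono (h : IsProfile n p J) {θ : ℝ} (h0 : 0 ≤ θ) (h1 : θ ≤ 1) {f g : Obs}
    (hfg : f ≤ g) : stepOp θ p f ≤ stepOp θ p g :=
  moveOp_mono h (lazyFlip_mono h0 h1 hfg)

theorem stepOp_pow_mono (h : IsProfile n p J) {θ : ℝ} (h0 : 0 ≤ θ) (h1 : θ ≤ 1) {f g : Obs}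
    (hfg : f ≤ g) (s : ℕ) : (stepOp θ p ^ s) f ≤ (stepOp θ p ^ s) g := by
  induction s with
  | zero => exact hfg
  | succ s ih =>
    rw [pow_succ', Module.End.mul_apply, Module.End.mul_apply]
    exact stepOp_mono h h0 h1 ih

theorem stepOp_pow_const (θ : ℝ) (p : ℤ → ℝ) (r : ℝ) (s : ℕ) :
    (stepOp θ p ^ s) (fun _ _ => r) = fun _ _ => r := by
  have e : (fun _ _ => r : Obs) = r • 1 := by ext; simp
  induction s with
  | zero => rfl
  | succ s ih =>
    rw [pow_succ, Module.End.mul_apply]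
    conv_lhs => rw [e, map_smul, stepOp_one, ← e, ih]

theorem stepOp_pow_abs_le (h : IsProfile n p J) {θ : ℝ} (h0 : 0 ≤ θ) (h1 : θ ≤ 1) (f : Obs)
    (s : ℕ) : |(stepOp θ p ^ s) f| ≤ (stepOp θ p ^ s) |f| := by
  rw [abs_le']
  constructor
  · exact stepOp_pow_mono h h0 h1 (le_abs_self f) s
  · rw [← map_neg]
    exact stepOp_pow_mono h h0 h1 (neg_le_abs f) s

theorem stepOp_pow_bound (h : IsProfile n p J) {θ : ℝ} (h0 : 0 ≤ θ) (h1 : θ ≤ 1) {f : Obs}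
    {B : ℝ} (hf : ∀ ε j, |f ε j| ≤ B) (s : ℕ) (ε : ℤˣ) (j : ℤ) :
    |(stepOp θ p ^ s) f ε j| ≤ B := by
  have h2 := stepOp_pow_abs_le h h0 h1 f s ε j
  have h3 := stepOp_pow_mono h h0 h1 (g := fun _ _ => B) hf s ε j
  rw [stepOp_pow_const] at h3
  exact h2.trans h3

theorem mean_stepOp_pow (h : IsProfile n p J) (θ : ℝ) (u : Obs) (s : ℕ) :
    mean n p ((stepOp θ p ^ s) u) = mean n p u := by
  induction s with
  | zero => rfl
  | succ s ih => rw [pow_succ', Module.End.mul_apply, mean_stepOp h, ih]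

theorem mean_sq_moveOp_le (h : IsProfile n p J) (u : Obs) :
    mean n p (moveOp p u ^ 2) ≤ mean n p (u ^ 2) := by
  rw [← mean_moveOp h (u ^ 2)]
  refine mean_mono h fun ε j _ _ => ?_
  simp only [Pi.pow_apply, moveOp_apply]
  have h1 := mul_nonneg (mul_nonneg (acc_nonneg h ε j) (sub_nonneg.2 (acc_le_one p ε j)))
    (sq_nonneg (u (-ε) (j + ε) - u ε j))
  linarith

theorem mean_sq_lazyFlip (n : ℕ) (p : ℤ → ℝ) (θ : ℝ) (f : Obs) :
    mean n p (lazyFlip θ f ^ 2) = mean n p (f ^ 2) - 4 * θ * (1 - θ) * oddSq n p f := by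
  rw [mean_apply, mean_apply, oddSq, Finset.mul_sum, ← Finset.sum_sub_distrib]
  refine Finset.sum_congr rfl fun j _ => ?_
  simp only [Pi.pow_apply, lazyFlip_apply, oddPart, neg_neg]
  ring

theorem oddSq_nonneg (h : IsProfile n p J) (f : Obs) : 0 ≤ oddSq n p f :=
  Finset.sum_nonneg fun j _ => mul_nonneg (h.nonneg j) (sq_nonneg _)

/-- The move is an averaging that preserves the mean, so it cannot increase the second moment. The
flip loses exactly `4 θ (1 - θ)` times the odd energy, which is at least `2 θ` times it for `θ ≤
1/2`. -/
theorem mean_sq_stepOp_le (h : IsProfile n p J) {θ : ℝ} (h0 : 0 ≤ θ) (h1 : θ ≤ 1 / 2)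
    (f : Obs) : mean n p (stepOp θ p f ^ 2) + 2 * θ * oddSq n p f ≤ mean n p (f ^ 2) := by
  have h2 := mean_sq_moveOp_le h (lazyFlip θ f)
  rw [mean_sq_lazyFlip] at h2
  rw [stepOp_apply]
  have := oddSq_nonneg h f
  have : 0 ≤ θ * (1 - 2 * θ) * oddSq n p f :=
    mul_nonneg (mul_nonneg h0 (by linarith)) this
  linarith

end

/-! ### The Poisson equation and time averages -/

section

variable {n : ℕ} {p : ℤ → ℝ} {J : ℤ}

theorem abs_pair_le (h : IsProfile n p J) {w : Obs} {η : ℝ}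
    (hw : ∀ ε (j : ℤ), 1 ≤ j → j ≤ n → |w ε j| ≤ η) (j : ℤ) :
    |p j * w 1 j + p (j + 1) * w (-1) (j + 1)| ≤ (p j + p (j + 1)) * η := by
  have key : ∀ ε i, |p i * w ε i| ≤ p i * η := by
    intro ε i
    rw [abs_mul, abs_of_nonneg (h.nonneg i)]
    by_cases h0 : p i = 0
    · simp [h0]
    · obtain ⟨h1, h2⟩ := h.mem_of_ne_zero h0
      exact mul_le_mul_of_nonneg_left (hw ε i h1 h2) (h.nonneg i)
  have := abs_add_le (p j * w 1 j) (p (j + 1) * w (-1) (j + 1))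
  have := key 1 j
  have := key (-1) (j + 1)
  linarith

theorem abs_le_of_sub_le {a b c d : ℝ} (h : |a - b| ≤ c) (h' : |b| ≤ d) : |a| ≤ d + c := by
  have := abs_add_le (a - b) b
  rw [sub_add_cancel] at this
  linarith

/-- The odd part of a solution of the Poisson equation is bounded. -/
theorem oddPart_le (h : IsProfile n p J) {θ η : ℝ} (h1 : θ ≤ 1 / 2) (hη : 0 ≤ η)
    {g w : Obs} (hg : ∀ ε j, g ε j - stepOp θ p g ε j = w ε j)
    (hw : ∀ ε (j : ℤ), 1 ≤ j → j ≤ n → |w ε j| ≤ η) {j : ℤ} (hj : 1 ≤ j) (hj' : j ≤ n) :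
    |oddPart g j| ≤ 2 * n * η := by
  -- Conservation of mass on a communicating pair leaves only the difference of odd fluxes, with
  -- coefficient `2 - 2 θ ≥ 1`.
  have step : ∀ i, |p i * oddPart g i - p (i + 1) * oddPart g (i + 1)| ≤
      (p i + p (i + 1)) * η := by
    intro i
    have e1 := moveOp_flux h (lazyFlip θ g) i
    have e2 := hg 1 i
    have e3 := hg (-1) (i + 1)
    rw [stepOp_apply] at e2 e3
    simp only [lazyFlip_apply, neg_neg] at e1
    have e4 : (2 - 2 * θ) * (p i * oddPart g i - p (i + 1) * oddPart g (i + 1)) =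
        p i * w 1 i + p (i + 1) * w (-1) (i + 1) := by
      simp only [oddPart]
      linear_combination e1 + p i * e2 + p (i + 1) * e3
    have e5 := abs_pair_le h hw i
    rw [← e4, abs_mul, abs_of_nonneg (by linarith : (0 : ℝ) ≤ 2 - 2 * θ)] at e5
    refine le_trans ?_ e5
    exact le_mul_of_one_le_left (abs_nonneg _) (by linarith)
  have hn : (j : ℝ) ≤ n := by exact_mod_cast hj'
  have hj1 : (1 : ℝ) ≤ j := by exact_mod_cast hj
  -- Sum the edge bounds from the end lying on the same side of the mode as `j`. The flux vanishes
  -- just beyond that end, and `p` increases towards `j`, so every weight met is at most `p j`.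
  have main : |p j * oddPart g j| ≤ 2 * n * η * p j := by
    rcases le_total J j with hJ | hJ
    · have key : ∀ k : ℕ, ∀ i : ℤ, J ≤ i → i + k = n + 1 →
          |p i * oddPart g i| ≤ 2 * k * η * p i := by
        intro k
        induction k with
        | zero =>
          intro i _ hi
          rw [h.zero_right i (by push_cast at hi; omega)]
          simp
        | succ k ih =>
          intro i hi hk
          have h3 := ih (i + 1) (by omega) (by push_cast at hk; omega)
          have h4 := abs_le_of_sub_le (step i) h3
          have h5 := h.succ_le i hi
          have h6 : 0 ≤ (2 * (k : ℝ) + 1) * η := by positivity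
          have h7 := mul_le_mul_of_nonneg_left h5 h6
          push_cast
          linarith
      have := key (n + 1 - j).toNat j hJ (by omega)
      refine this.trans (mul_le_mul_of_nonneg_right ?_ (h.nonneg j))
      refine mul_le_mul_of_nonneg_right ?_ hη
      have : ((n + 1 - j).toNat : ℝ) = n + 1 - j := by
        have : ((n + 1 - j).toNat : ℤ) = n + 1 - j := Int.toNat_of_nonneg (by omega)
        exact_mod_cast this
      rw [this]; linarith
    · have key : ∀ k : ℕ, (k : ℤ) ≤ J → |p k * oddPart g k| ≤ 2 * k * η * p k := by
        intro k
        induction k with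
        | zero => intro _; rw [h.zero_left _ (by simp)]; simp
        | succ k ih =>
          intro hk
          push_cast at hk ⊢
          have h3 := ih (by omega)
          have h0 := step k
          rw [abs_sub_comm] at h0
          have h4 := abs_le_of_sub_le h0 h3
          have h5 := h.le_succ k (by omega)
          have h6 : 0 ≤ (2 * (k : ℝ) + 1) * η := by positivity
          have h7 := mul_le_mul_of_nonneg_left h5 h6
          linarith
      have e : ((j.toNat : ℕ) : ℤ) = j := Int.toNat_of_nonneg (by omega)
      have h3 := key j.toNat (by omega)
      have e' : ((j.toNat : ℕ) : ℝ) = j := by exact_mod_cast e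
      rw [e, e'] at h3
      refine h3.trans (mul_le_mul_of_nonneg_right ?_ (h.nonneg j))
      refine mul_le_mul_of_nonneg_right ?_ hη
      linarith
  have hp := h.pos j hj hj'
  rw [abs_mul, abs_of_pos hp, mul_comm] at main
  exact le_of_mul_le_mul_right main hp

theorem IsProfile.one_le_size (h : IsProfile n p J) : (1 : ℝ) ≤ n := by
  have := h.one_le
  have := h.le_size
  have : 1 ≤ n := by omega
  exact_mod_cast this

/-- A centred solution of the Poisson equation is at most of order `n` times the source. -/
theorem poisson_bound (h : IsProfile n p J) {θ η : ℝ} (h0 : 0 ≤ θ) (h1 : θ ≤ 1 / 2)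
    (hθ : θ * n ≤ 1) (hη : 0 ≤ η) {g w : Obs} (hg : ∀ ε j, g ε j - stepOp θ p g ε j = w ε j)
    (hw : ∀ ε (j : ℤ), 1 ≤ j → j ≤ n → |w ε j| ≤ η) (hm : mean n p g = 0) (ε : ℤˣ) {j : ℤ}
    (hj : 1 ≤ j) (hj' : j ≤ n) : |g ε j| ≤ 26 * n * η := by
  have ho := fun {i : ℤ} => oddPart_le h h1 hη hg hw (j := i)
  have hn := h.one_le_size
  have hθo : ∀ i : ℤ, 1 ≤ i → i ≤ n → |2 * θ * oddPart g i| ≤ 4 * η := by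
    intro i hi hi'
    rw [abs_mul, abs_of_nonneg (by positivity : 0 ≤ 2 * θ)]
    have h2 := mul_le_mul_of_nonneg_left (ho hi hi') (by positivity : 0 ≤ 2 * θ)
    have h3 := mul_le_mul_of_nonneg_right hθ (by positivity : 0 ≤ 4 * η)
    linarith
  -- A move towards the mode is accepted surely, so the equation compares two neighbouring inward
  -- states directly: `η` comes from the source and `4 η` from the omitted flip.
  have left : ∀ i : ℤ, 1 ≤ i → i < J → |g 1 i - g 1 (i + 1)| ≤ 5 * η := by
    intro i hi hiJ
    have hJn := h.le_size
    have ha : acc p 1 i = 1 := acc_eq_one (h.pos i hi (by omega)) (by simpa using h.le_succ i hiJ)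
    have e := hg 1 i
    rw [stepOp_apply, moveOp_apply, ha] at e
    simp only [lazyFlip_apply, neg_neg, Units.val_one] at e
    have e2 : g 1 i - g 1 (i + 1) = w 1 i - 2 * θ * oddPart g (i + 1) := by
      simp only [oddPart]; linear_combination e
    rw [e2]
    have := abs_sub (w 1 i) (2 * θ * oddPart g (i + 1))
    have := hθo (i + 1) (by omega) (by omega)
    have := hw 1 i hi (by omega)
    linarith
  have right : ∀ i : ℤ, J ≤ i → i + 1 ≤ n → |g (-1) (i + 1) - g (-1) i| ≤ 5 * η := by
    intro i hi hin
    have hJ1 := h.one_le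
    have ha : acc p (-1) (i + 1) = 1 :=
      acc_eq_one (h.pos _ (by omega) (by omega)) (by simpa using h.succ_le i hi)
    have e := hg (-1) (i + 1)
    rw [stepOp_apply, moveOp_apply, ha] at e
    have e0 : i + 1 + ((-1 : ℤˣ) : ℤ) = i := by simp
    simp only [lazyFlip_apply, neg_neg, e0] at e
    have e2 : g (-1) (i + 1) - g (-1) i = w (-1) (i + 1) + 2 * θ * oddPart g i := by
      simp only [oddPart]; linear_combination e
    rw [e2]
    have := abs_add_le (w (-1) (i + 1)) (2 * θ * oddPart g i)
    have := hθo i (by omega) (by omega)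
    have := hw (-1) (i + 1) (by omega) hin
    linarith
  have left' : ∀ k : ℕ, (k : ℤ) < J → |g 1 (J - k) - g 1 J| ≤ 5 * k * η := by
    intro k
    induction k with
    | zero => simp
    | succ k ih =>
      intro hk
      push_cast at hk ⊢
      have h2 := left (J - (k + 1)) (by omega) (by omega)
      rw [show J - ((k : ℤ) + 1) + 1 = J - k by ring] at h2
      have h3 := abs_sub_le (g 1 (J - (k + 1))) (g 1 (J - k)) (g 1 J)
      have := ih (by omega)
      linarith
  have right' : ∀ k : ℕ, J + (k : ℤ) ≤ n → |g (-1) (J + k) - g (-1) J| ≤ 5 * k * η := by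
    intro k
    induction k with
    | zero => simp
    | succ k ih =>
      intro hk
      push_cast at hk ⊢
      have h2 := right (J + k) (by omega) (by omega)
      rw [add_assoc] at h2
      have h3 := abs_sub_le (g (-1) (J + (k + 1))) (g (-1) (J + k)) (g (-1) J)
      have := ih (by omega)
      linarith
  have odd : ∀ i : ℤ, 1 ≤ i → i ≤ n → |g 1 i - g (-1) i| ≤ 4 * n * η := by
    intro i hi hi'
    have := ho hi hi'
    rw [show g 1 i - g (-1) i = 2 * oddPart g i by simp only [oddPart]; ring, abs_mul, abs_two]
    linarith
  -- Compare along inward states, at cost `5 n η`, and change sign at the site and at the mode when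
  -- needed, at cost `4 n η` each.
  have osc : ∀ ε (i : ℤ), 1 ≤ i → i ≤ n → |g ε i - g 1 J| ≤ 13 * n * η := by
    intro ε i hi hi'
    have hJ1 := h.one_le
    have hJn := h.le_size
    have o1 := odd i hi hi'
    have o2 := odd J hJ1 hJn
    have hnη : 0 ≤ n * η := by positivity
    rcases le_total i J with hiJ | hiJ
    · have h2 := left' (J - i).toNat (by omega)
      have e : (((J - i).toNat : ℕ) : ℤ) = J - i := Int.toNat_of_nonneg (by omega)
      have e' : (((J - i).toNat : ℕ) : ℝ) ≤ n := by
        have : (J - i).toNat ≤ n := by omega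
        exact_mod_cast this
      rw [e, sub_sub_cancel] at h2
      have h3 := mul_le_mul_of_nonneg_right e' hη
      rcases Int.units_eq_one_or ε with rfl | rfl
      · linarith
      · have := abs_sub_le (g (-1) i) (g 1 i) (g 1 J)
        rw [abs_sub_comm (g (-1) i) (g 1 i)] at this
        linarith
    · have h2 := right' (i - J).toNat (by omega)
      have e : (((i - J).toNat : ℕ) : ℤ) = i - J := Int.toNat_of_nonneg (by omega)
      have e' : (((i - J).toNat : ℕ) : ℝ) ≤ n := by
        have : (i - J).toNat ≤ n := by omega
        exact_mod_cast this
      rw [e, add_sub_cancel] at h2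
      have h3 := mul_le_mul_of_nonneg_right e' hη
      have h4 := abs_sub_le (g (-1) i) (g (-1) J) (g 1 J)
      rw [abs_sub_comm (g (-1) J) (g 1 J)] at h4
      rcases Int.units_eq_one_or ε with rfl | rfl
      · have := abs_sub_le (g 1 i) (g (-1) i) (g 1 J)
        linarith
      · linarith
  have hc : |g 1 J| ≤ 13 * n * η := by
    rw [abs_le]
    constructor
    · have := mean_mono h (f := g) (g := fun _ _ => g 1 J + 13 * n * η) fun ε i hi hi' => by
        have := (abs_le.1 (osc ε i hi hi')).2
        linarith
      rw [hm, mean_const h] at this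
      linarith
    · have := mean_mono h (g := g) (f := fun _ _ => g 1 J - 13 * n * η) fun ε i hi hi' => by
        have := (abs_le.1 (osc ε i hi hi')).1
        linarith
      rw [hm, mean_const h] at this
      linarith
  have := abs_le_of_sub_le (osc ε j hj hj') hc
  linarith

/-- Time averages converge uniformly at rate `n / S`. -/
theorem abs_sum_pow_le (h : IsProfile n p J) {θ : ℝ} (h0 : 0 ≤ θ) (h1 : θ ≤ 1 / 2)
    (hθ : θ * n ≤ 1) {f : Obs} (hf : ∀ ε j, |f ε j| ≤ 1) (hm : mean n p f = 0) (S : ℕ)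
    (ε : ℤˣ) {j : ℤ} (hj : 1 ≤ j) (hj' : j ≤ n) :
    |(∑ s ∈ Finset.range S, (stepOp θ p ^ s) f) ε j| ≤ 52 * n := by
  -- The geometric sum telescopes to a source of size at most 2, whence `52 = 26 * 2`.
  have key : ∀ ε j, (∑ s ∈ Finset.range S, (stepOp θ p ^ s) f) ε j -
      stepOp θ p (∑ s ∈ Finset.range S, (stepOp θ p ^ s) f) ε j =
      (f - (stepOp θ p ^ S) f) ε j := by
    intro ε j
    have := congrArg (fun T : Module.End ℝ Obs => T f ε j) (mul_neg_geom_sum (stepOp θ p) S)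
    simpa [LinearMap.sum_apply, sub_mul] using this
  have := poisson_bound h h0 h1 hθ zero_le_two key (fun ε j _ _ => ?_) ?_ ε hj hj'
  · linarith
  · have h2 := abs_sub (f ε j) ((stepOp θ p ^ S) f ε j)
    have := hf ε j
    have := stepOp_pow_bound h h0 (by linarith) hf S ε j
    simp only [Pi.sub_apply]
    linarith
  · rw [map_sum]
    exact Finset.sum_eq_zero fun s _ => by rw [mean_stepOp_pow h, hm]

theorem abs_sum_pow_sub_le (h : IsProfile n p J) {θ : ℝ} (h0 : 0 ≤ θ) (h1 : θ ≤ 1 / 2)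
    (hθ : θ * n ≤ 1) {f : Obs} (hf0 : 0 ≤ f) (hf1 : f ≤ 1) (S : ℕ) (ε : ℤˣ) {j : ℤ}
    (hj : 1 ≤ j) (hj' : j ≤ n) :
    |(∑ s ∈ Finset.range S, (stepOp θ p ^ s) f) ε j - S * mean n p f| ≤ 52 * n := by
  set m := mean n p f with hm
  have hm0 : 0 ≤ m := by
    have := mean_mono h (f := 0) (g := f) fun ε j _ _ => hf0 ε j
    rwa [map_zero] at this
  have hm1 : m ≤ 1 := by
    rw [← mean_one h]; exact mean_mono h fun ε j _ _ => hf1 ε j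
  have h2 := abs_sum_pow_le h h0 h1 hθ (f := f - fun _ _ => m)
    (fun ε j => by
      have h2 := hf0 ε j
      have h3 := hf1 ε j
      simp only [Pi.zero_apply, Pi.one_apply] at h2 h3
      simp only [Pi.sub_apply]
      rw [abs_le]; constructor <;> linarith)
    (by rw [map_sub, mean_const h, hm, sub_self]) S ε hj hj'
  have e : (∑ s ∈ Finset.range S, (stepOp θ p ^ s) (f - fun _ _ => m)) ε j =
      (∑ s ∈ Finset.range S, (stepOp θ p ^ s) f) ε j - S * m := by
    simp only [map_sub, stepOp_pow_const, Finset.sum_sub_distrib, Pi.sub_apply]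
    simp
  rwa [e] at h2

end

/-! ### Behaviour near -1 and decay in mean square -/

/-- The part of a function that is odd in the sign. -/
noncomputable def oddObs (f : Obs) : Obs := fun ε j => (f ε j - f (-ε) j) / 2

theorem sum_pow_add_sum_neg_pow {R : Type*} [Ring R] (x : R) (S : ℕ) :
    ∑ s ∈ Finset.range (2 * S), x ^ s + ∑ s ∈ Finset.range (2 * S), (-x) ^ s =
      ∑ s ∈ Finset.range S, x ^ (s + s) + ∑ s ∈ Finset.range S, x ^ (s + s) := by
  induction S with
  | zero => simp
  | succ S ih =>
    have e1 : (-x) ^ (2 * S) = x ^ (S + S) := by rw [Even.neg_pow (even_two_mul S), two_mul]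
    have e2 : (-x) ^ (2 * S + 1) = -x ^ (2 * S + 1) :=
      Odd.neg_pow (odd_two_mul_add_one S) x
    rw [show 2 * (S + 1) = 2 * S + 1 + 1 by ring, Finset.sum_range_succ, Finset.sum_range_succ,
      Finset.sum_range_succ (n := 2 * S + 1), Finset.sum_range_succ (n := 2 * S),
      Finset.sum_range_succ (n := S), add_add_add_comm (∑ s ∈ Finset.range S, x ^ (s + s)), ← ih, e1, e2,
      ← two_mul S]
    abel

section

variable {n : ℕ} {p : ℤ → ℝ} {J : ℤ}

theorem sq_mean_le (h : IsProfile n p J) (f : Obs) : mean n p f ^ 2 ≤ mean n p (f ^ 2) := by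
  have h1 := mean_mono h (f := 0) (g := (f - mean n p f • 1) ^ 2) fun ε j _ _ => by
    simp only [Pi.zero_apply, Pi.pow_apply]; positivity
  have e : (f - mean n p f • 1) ^ 2 =
      f ^ 2 - (2 * mean n p f) • f + (mean n p f ^ 2) • (1 : Obs) := by
    ext ε j
    simp only [Pi.pow_apply, Pi.sub_apply, Pi.add_apply, Pi.smul_apply, Pi.one_apply, smul_eq_mul]
    ring
  rw [e, map_add, map_sub, map_smul, map_smul, mean_one h, map_zero, smul_eq_mul, smul_eq_mul]
    at h1
  linarith

theorem mean_abs_oddObs (n : ℕ) (p : ℤ → ℝ) (f : Obs) :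
    mean n p |oddObs f| = ∑ j ∈ Finset.Icc 1 (n : ℤ), p j * |oddPart f j| := by
  rw [mean_apply]
  refine Finset.sum_congr rfl fun j _ => ?_
  have : |oddObs f| (-1) j = |oddPart f j| := by
    simp only [Pi.abs_apply, oddObs, oddPart, neg_neg]
    rw [← abs_neg]; congr 1; ring
  rw [this]
  simp only [Pi.abs_apply, oddObs, oddPart]
  ring

theorem mean_sq_oddObs (n : ℕ) (p : ℤ → ℝ) (f : Obs) :
    mean n p (|oddObs f| ^ 2) = oddSq n p f := by
  rw [mean_apply, oddSq]
  refine Finset.sum_congr rfl fun j _ => ?_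
  simp only [Pi.abs_apply, Pi.pow_apply, oddObs, oddPart, neg_neg, sq_abs]
  ring

theorem sq_mean_abs_oddObs_le (h : IsProfile n p J) (f : Obs) :
    mean n p |oddObs f| ^ 2 ≤ oddSq n p f := by
  rw [← mean_sq_oddObs]
  exact sq_mean_le h _

/-- Since `P g` is nearly `-g`, almost no energy is lost in the step, and the loss bounds the odd
part. -/
theorem oddSq_le_of_add_step (h : IsProfile n p J) {θ η : ℝ} (h0 : 0 ≤ θ) (h1 : θ ≤ 1 / 2)
    (hθ : θ * n = 1) {g w : Obs} (hg1 : ∀ ε j, |g ε j| ≤ 1)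
    (hg : ∀ ε j, g ε j + stepOp θ p g ε j = w ε j)
    (hw : ∀ ε (j : ℤ), 1 ≤ j → j ≤ n → |w ε j| ≤ η) : oddSq n p g ≤ n * η := by
  have h2 := mean_sq_stepOp_le h h0 h1 g
  have h3 : mean n p (g ^ 2 - fun _ _ => 2 * η) ≤ mean n p (stepOp θ p g ^ 2) := by
    refine mean_mono h fun ε j hj hj' => ?_
    have e : stepOp θ p g ε j = w ε j - g ε j := by rw [← hg]; ring
    simp only [Pi.sub_apply, Pi.pow_apply, e]
    have h4 : w ε j * g ε j ≤ η := by
      refine (le_abs_self _).trans ?_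
      rw [abs_mul]
      exact (mul_le_of_le_one_right (abs_nonneg _) (hg1 ε j)).trans (hw ε j hj hj')
    have := sq_nonneg (w ε j)
    linarith
  rw [map_sub, mean_const h] at h3
  have h4 : θ * oddSq n p g ≤ η := by linarith
  have h5 := mul_le_mul_of_nonneg_left h4 (Nat.cast_nonneg n : (0 : ℝ) ≤ n)
  have h6 : (n : ℝ) * (θ * oddSq n p g) = oddSq n p g := by rw [← mul_assoc, mul_comm _ θ, hθ,
    one_mul]
  linarith

/-- The sampler has no approximate eigenvalue `-1` at scale `1 / n`. -/
theorem mean_abs_le_of_add_step (h : IsProfile n p J) {θ η : ℝ} (h0 : 0 ≤ θ) (h1 : θ ≤ 1 / 2)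
    (hθ : θ * n = 1) (hη : 0 ≤ η) {g w : Obs} (hg1 : ∀ ε j, |g ε j| ≤ 1)
    (hg : ∀ ε j, g ε j + stepOp θ p g ε j = w ε j)
    (hw : ∀ ε (j : ℤ), 1 ≤ j → j ≤ n → |w ε j| ≤ η) :
    mean n p |g| ≤ 3 * √(n * η) + n * η := by
  set O := mean n p |oddObs g| with hO
  have hOle : O ≤ √(n * η) :=
    Real.le_sqrt_of_sq_le ((sq_mean_abs_oddObs_le h g).trans
      (oddSq_le_of_add_step h h0 h1 hθ hg1 hg hw))
  set e : ℤ → ℝ := fun j => (g 1 j + g (-1) j) / 2 with he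
  set q : ℤ → ℝ := fun j => θ * (p j * |oddPart g j|) + p j * (η / 2) with hq
  have hq0 : ∀ j, 0 ≤ q j := fun j => by
    have := h.nonneg j
    simp only [hq]; positivity
  -- On a pair, the even flux changes sign from one site to the next up to the small errors `q`.
  -- Starting from `p 0 = 0`, it therefore stays below twice the total error.
  have step : ∀ j, p (j + 1) * |e (j + 1)| ≤ p j * |e j| + q j + q (j + 1) := by
    intro j
    have e1 := moveOp_flux h (lazyFlip θ g) j
    have e2 := hg 1 j
    have e3 := hg (-1) (j + 1)
    rw [stepOp_apply] at e2 e3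
    simp only [lazyFlip_apply, neg_neg] at e1
    have e4 : p (j + 1) * e (j + 1) = -(p j * e j) - θ * (p j * oddPart g j) +
        θ * (p (j + 1) * oddPart g (j + 1)) +
        (p j * w 1 j + p (j + 1) * w (-1) (j + 1)) / 2 := by
      simp only [oddPart, he]
      linear_combination (-1 / 2) * e1 + (p j / 2) * e2 + (p (j + 1) / 2) * e3
    have e5 := abs_le.1 (abs_pair_le h hw j)
    have a0 : ∀ i x, p i * |x| = |p i * x| := fun i x => by
      rw [abs_mul, abs_of_nonneg (h.nonneg i)]
    simp only [hq, a0]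
    rw [e4]
    have b1 := abs_le.1 (le_refl |p j * e j|)
    have b2 : |θ * (p j * oddPart g j)| ≤ θ * |p j * oddPart g j| := by
      rw [abs_mul, abs_of_nonneg h0]
    have b3 : |θ * (p (j + 1) * oddPart g (j + 1))| ≤ θ * |p (j + 1) * oddPart g (j + 1)| := by
      rw [abs_mul, abs_of_nonneg h0]
    have b2 := abs_le.1 b2
    have b3 := abs_le.1 b3
    rw [abs_le]
    constructor <;> linarith [e5.1, e5.2, b1.1, b1.2, b2.1, b2.2, b3.1, b3.2]
  have ind : ∀ k : ℕ, p k * |e k| + q k ≤ 2 * ∑ i ∈ Finset.Icc 1 (k : ℤ), q i := by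
    intro k
    induction k with
    | zero => simp [hq, h.zero_left 0 le_rfl]
    | succ k ih =>
      have e1 : Finset.Icc 1 ((k : ℤ) + 1) = insert ((k : ℤ) + 1) (Finset.Icc 1 (k : ℤ)) := by
        ext i; simp only [Finset.mem_Icc, Finset.mem_insert]; omega
      push_cast
      rw [e1, Finset.sum_insert (by simp)]
      have := step k
      linarith
  have tot : ∑ i ∈ Finset.Icc 1 (n : ℤ), q i = θ * O + η / 2 := by
    simp only [hq]
    rw [Finset.sum_add_distrib, ← Finset.mul_sum, ← Finset.sum_mul, h.sum_eq_one, hO,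
      mean_abs_oddObs]
    ring
  have bound : ∀ j ∈ Finset.Icc 1 (n : ℤ), p j * |e j| ≤ 2 * θ * O + η := by
    intro j hj
    rw [Finset.mem_Icc] at hj
    have h2 := ind j.toNat
    have h3 : ((j.toNat : ℕ) : ℤ) = j := Int.toNat_of_nonneg (by omega)
    rw [h3] at h2
    have h4 : ∑ i ∈ Finset.Icc 1 j, q i ≤ ∑ i ∈ Finset.Icc 1 (n : ℤ), q i :=
      Finset.sum_le_sum_of_subset_of_nonneg (Finset.Icc_subset_Icc le_rfl hj.2)
        fun i _ _ => hq0 i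
    have := hq0 j
    rw [tot] at h4
    linarith
  have hsum : ∑ j ∈ Finset.Icc 1 (n : ℤ), p j * |e j| ≤ 2 * O + n * η := by
    refine (Finset.sum_le_card_nsmul _ _ _ bound).trans ?_
    rw [Int.card_Icc, nsmul_eq_mul]
    have : (((n : ℤ) + 1 - 1).toNat : ℝ) = n := by simp
    rw [this]
    linear_combination (2 * O) * hθ
  have hfin : mean n p |g| ≤ ∑ j ∈ Finset.Icc 1 (n : ℤ), p j * |e j| + O := by
    rw [hO, mean_abs_oddObs, mean_apply, ← Finset.sum_add_distrib]
    refine Finset.sum_le_sum fun j _ => ?_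
    rw [← mul_add]
    refine mul_le_mul_of_nonneg_left ?_ (h.nonneg j)
    have e1 : g 1 j = e j + oddPart g j := by simp only [he, oddPart]; ring
    have e2 : g (-1) j = e j - oddPart g j := by simp only [he, oddPart]; ring
    have := abs_add_le (e j) (oddPart g j)
    have := abs_sub (e j) (oddPart g j)
    simp only [Pi.abs_apply]
    rw [e1, e2]
    linarith
  linarith

/-- The flip composed with a power of `P` is an alternating palindrome of self-adjoint factors,
hence self-adjoint. This replaces the missing self-adjointness of `P`. -/
theorem mean_stepOp_pow_mul_lazyFlip (h : IsProfile n p J) (θ : ℝ) (s : ℕ) (a b : Obs) :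
    mean n p ((stepOp θ p ^ s) a * lazyFlip θ b) =
      mean n p (lazyFlip θ a * (stepOp θ p ^ s) b) := by
  induction s generalizing a with
  | zero => exact (mean_lazyFlip_mul n p θ a b).symm
  | succ s ih =>
    rw [pow_succ, Module.End.mul_apply, ih, ← pow_succ, pow_succ', Module.End.mul_apply,
      mean_lazyFlip_mul, stepOp_apply, stepOp_apply, mean_moveOp_mul h]

theorem mean_lazyFlip_mul_eq (n : ℕ) (p : ℤ → ℝ) (θ : ℝ) (u v : Obs) :
    mean n p (u * lazyFlip θ v) = mean n p (u * v) - 2 * (1 - θ) * mean n p (u * oddObs v) := by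
  have : u * lazyFlip θ v = u * v - (2 * (1 - θ)) • (u * oddObs v) := by
    ext ε j
    simp only [Pi.mul_apply, Pi.sub_apply, Pi.smul_apply, smul_eq_mul, lazyFlip_apply, oddObs]
    ring
  rw [this, map_sub, map_smul, smul_eq_mul]

theorem mean_mul_oddObs (n : ℕ) (p : ℤ → ℝ) (u : Obs) :
    mean n p (u * oddObs u) = oddSq n p u := by
  rw [mean_apply, oddSq]
  refine Finset.sum_congr rfl fun j _ => ?_
  simp only [Pi.mul_apply, oddObs, oddPart, neg_neg]
  ring

theorem abs_mean_mul_le (h : IsProfile n p J) {u v : Obs} {B : ℝ}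
    (hu : ∀ ε (j : ℤ), 1 ≤ j → j ≤ n → |u ε j| ≤ B) :
    |mean n p (u * v)| ≤ B * mean n p |v| := by
  have h1 : ∀ ε (j : ℤ), 1 ≤ j → j ≤ n → |u ε j * v ε j| ≤ B * |v ε j| := fun ε j hj hj' => by
    rw [abs_mul]
    exact mul_le_mul_of_nonneg_right (hu ε j hj hj') (abs_nonneg _)
  have e : B * mean n p |v| = mean n p (B • |v|) := by rw [map_smul, smul_eq_mul]
  rw [e, abs_le']
  refine ⟨mean_mono h fun ε j hj hj' => (le_abs_self _).trans (h1 ε j hj hj'), ?_⟩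
  rw [← map_neg]
  exact mean_mono h fun ε j hj hj' => (neg_le_abs _).trans (h1 ε j hj hj')

theorem mean_abs_le_one (h : IsProfile n p J) {f : Obs} (hf : ∀ ε j, |f ε j| ≤ 1) :
    mean n p |f| ≤ 1 := by
  rw [← mean_one h]
  exact mean_mono h fun ε j _ _ => hf ε j

theorem sum_oddSq_le (h : IsProfile n p J) {θ : ℝ} (h0 : 0 ≤ θ) (h1 : θ ≤ 1 / 2) (f : Obs)
    (S : ℕ) : 2 * θ * ∑ s ∈ Finset.range S, oddSq n p ((stepOp θ p ^ s) f) +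
      mean n p (((stepOp θ p ^ S) f) ^ 2) ≤ mean n p (f ^ 2) := by
  induction S with
  | zero => simp
  | succ S ih =>
    rw [Finset.sum_range_succ, pow_succ' (stepOp θ p), Module.End.mul_apply]
    have := mean_sq_stepOp_le h h0 h1 ((stepOp θ p ^ S) f)
    linarith

theorem mean_sq_stepOp_pow_anti (h : IsProfile n p J) {θ : ℝ} (h0 : 0 ≤ θ) (h1 : θ ≤ 1 / 2)
    (f : Obs) {s t : ℕ} (hst : s ≤ t) :
    mean n p (((stepOp θ p ^ t) f) ^ 2) ≤ mean n p (((stepOp θ p ^ s) f) ^ 2) := by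
  obtain ⟨k, rfl⟩ := Nat.exists_eq_add_of_le hst
  rw [add_comm, pow_add, Module.End.mul_apply]
  refine le_trans ?_ (sum_oddSq_le h h0 h1 ((stepOp θ p ^ s) f) k)
  have : 0 ≤ ∑ i ∈ Finset.range k, oddSq n p ((stepOp θ p ^ i) ((stepOp θ p ^ s) f)) :=
    Finset.sum_nonneg fun i _ => oddSq_nonneg h _
  exact le_add_of_nonneg_left (by positivity)

theorem mean_sq_le_one (h : IsProfile n p J) {f : Obs} (hf : ∀ ε j, |f ε j| ≤ 1) :
    mean n p (f ^ 2) ≤ 1 := by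
  rw [← mean_one h]
  refine mean_mono h fun ε j _ _ => ?_
  simp only [Pi.pow_apply, Pi.one_apply]
  exact (sq_le_one_iff_abs_le_one _).2 (hf ε j)

theorem mean_abs_sum_neg_pow_le (h : IsProfile n p J) {θ : ℝ} (h0 : 0 ≤ θ) (h1 : θ ≤ 1 / 2)
    (hθ : θ * n = 1) {f : Obs} (hf : ∀ ε j, |f ε j| ≤ 1) {q : ℕ} (hq : 0 < q) :
    mean n p |(∑ s ∈ Finset.range (2 * (q ^ 2 * n)), (-stepOp θ p) ^ s) f| ≤
      8 * (q ^ 2 * n : ℕ) / q := by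
  have hn := h.one_le_size
  have hq1 : (1 : ℝ) ≤ q := by exact_mod_cast hq
  set S := q ^ 2 * n with hS
  have hS' : (S : ℝ) = q ^ 2 * n := by rw [hS]; push_cast; ring
  have hS0 : (0 : ℝ) < S := by rw [hS']; positivity
  set G := (∑ s ∈ Finset.range (2 * S), (-stepOp θ p) ^ s) f with hG
  have hpow : ∀ s ε j, |((-stepOp θ p) ^ s) f ε j| ≤ 1 := by
    intro s ε j
    rcases Nat.even_or_odd s with hs | hs
    · rw [show (-stepOp θ p) ^ s = stepOp θ p ^ s from
        hs.neg_pow (α := Module.End ℝ Obs) (stepOp θ p)]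
      exact stepOp_pow_bound h h0 (by linarith) hf s ε j
    · rw [show (-stepOp θ p) ^ s = -stepOp θ p ^ s from
        hs.neg_pow (α := Module.End ℝ Obs) (stepOp θ p), LinearMap.neg_apply, Pi.neg_apply, Pi.neg_apply, abs_neg]
      exact stepOp_pow_bound h h0 (by linarith) hf s ε j
  have hGb : ∀ ε j, |G ε j| ≤ 2 * S := by
    intro ε j
    rw [hG, LinearMap.sum_apply, Finset.sum_apply, Finset.sum_apply]
    refine (Finset.abs_sum_le_sum_abs _ _).trans ?_
    refine (Finset.sum_le_card_nsmul _ _ 1 fun s _ => hpow s ε j).trans ?_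
    simp
  have hGe : G + stepOp θ p G = f - (stepOp θ p ^ (2 * S)) f := by
    have := congrArg (fun T : Module.End ℝ Obs => T f) (mul_neg_geom_sum (-stepOp θ p) (2 * S))
    rw [show (-stepOp θ p) ^ (2 * S) = stepOp θ p ^ (2 * S) from
      Even.neg_pow (α := Module.End ℝ Obs) (even_two_mul S) (stepOp θ p)] at this
    simpa [sub_mul, ← hG, add_mul] using this
  -- Dividing by the number `2 S` of terms makes the sum bounded by 1 with source `1/S`; the choice
  -- `S = q² n` turns `n/S` into `1/q²`.
  have key := mean_abs_le_of_add_step h h0 h1 hθ (η := 1 / S) (by positivity)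
    (g := (1 / (2 * S : ℝ)) • G) (w := (1 / (2 * S : ℝ)) • (f - (stepOp θ p ^ (2 * S)) f))
    (fun ε j => by
      rw [Pi.smul_apply, Pi.smul_apply, smul_eq_mul, abs_mul, abs_of_pos (by positivity),
        one_div, inv_mul_le_one₀ (by positivity)]
      exact hGb ε j)
    (fun ε j => by
      rw [map_smul, ← hGe]
      simp only [Pi.smul_apply, Pi.add_apply, smul_eq_mul]
      ring)
    (fun ε j _ _ => by
      rw [Pi.smul_apply, Pi.smul_apply, smul_eq_mul, abs_mul, abs_of_pos (by positivity)]
      have := abs_sub (f ε j) ((stepOp θ p ^ (2 * S)) f ε j)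
      have := hf ε j
      have := stepOp_pow_bound h h0 (by linarith) hf (2 * S) ε j
      have h2 : |(f - (stepOp θ p ^ (2 * S)) f) ε j| ≤ 2 := by
        simp only [Pi.sub_apply]; linarith
      calc 1 / (2 * S : ℝ) * |(f - (stepOp θ p ^ (2 * S)) f) ε j| ≤ 1 / (2 * S : ℝ) * 2 :=
            mul_le_mul_of_nonneg_left h2 (by positivity)
        _ = 1 / S := by field_simp)
  have e1 : |(1 / (2 * S : ℝ)) • G| = (1 / (2 * S : ℝ)) • |G| := by
    ext ε j
    simp only [Pi.abs_apply, Pi.smul_apply, smul_eq_mul]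
    rw [abs_mul, abs_of_pos (by positivity)]
  have e2 : (n : ℝ) * (1 / S) = (1 / q) ^ 2 := by rw [hS']; field_simp
  rw [e1, map_smul, smul_eq_mul, e2, Real.sqrt_sq (by positivity)] at key
  have h3 : (1 / (q : ℝ)) ^ 2 ≤ 1 / q := by
    rw [sq]; exact mul_le_of_le_one_left (by positivity) ((div_le_one (by positivity)).2 hq1)
  have h4 : 1 / (2 * S : ℝ) * mean n p |G| ≤ 4 * (1 / q) := by linarith
  have h5 := mul_le_mul_of_nonneg_left h4 (by positivity : (0 : ℝ) ≤ 2 * S)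
  have e3 : 2 * (S : ℝ) * (1 / (2 * S : ℝ) * mean n p |G|) = mean n p |G| := by field_simp
  rw [e3] at h5
  refine h5.trans (le_of_eq ?_)
  ring

/-- Bounded centred functions decay in mean square within order `n` steps. -/
theorem mean_sq_decay (h : IsProfile n p J) {θ : ℝ} (h0 : 0 ≤ θ) (h1 : θ ≤ 1 / 2)
    (hθ : θ * n = 1) {f : Obs} (hf : ∀ ε j, |f ε j| ≤ 1) (hm : mean n p f = 0) {q : ℕ}
    (hq : 0 < q) : mean n p (((stepOp θ p ^ (2 * (q ^ 2 * n))) f) ^ 2) ≤ 33 / q := by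
  have hn := h.one_le_size
  have hq1 : (1 : ℝ) ≤ q := by exact_mod_cast hq
  set S := q ^ 2 * n with hS
  have hS' : (S : ℝ) = q ^ 2 * n := by rw [hS]; push_cast; ring
  have hS0 : (0 : ℝ) < S := by rw [hS']; positivity
  have energy : ∀ f : Obs, (∀ ε j, |f ε j| ≤ 1) →
      ∑ s ∈ Finset.range S, oddSq n p ((stepOp θ p ^ s) f) ≤ n / 2 := by
    intro f hf
    have h2 := sum_oddSq_le h h0 h1 f S
    have h3 := mean_sq_le_one h hf
    have h4 : 0 ≤ mean n p (((stepOp θ p ^ S) f) ^ 2) := by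
      have := mean_mono h (f := 0) (g := ((stepOp θ p ^ S) f) ^ 2) fun ε j _ _ => by
        simp only [Pi.zero_apply, Pi.pow_apply]; positivity
      rwa [map_zero] at this
    set X := ∑ s ∈ Finset.range S, oddSq n p ((stepOp θ p ^ s) f)
    have h5 : 2 * θ * X ≤ 1 := by linarith
    have h6 := mul_le_mul_of_nonneg_left h5 (by positivity : (0 : ℝ) ≤ n / 2)
    have h7 : (n : ℝ) / 2 * (2 * θ * X) = X := by linear_combination X * hθ
    linarith
  -- The odd energies over `S = q² n` times total at most `n/2`, so some time has odd energy at most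
  -- `1/q²`. The argument restarts there, where exchanging the flip with the identity costs only
  -- `O(1/q)`.
  obtain ⟨s₀, hs₀, hodd⟩ : ∃ s₀ ∈ Finset.range S,
      oddSq n p ((stepOp θ p ^ s₀) f) ≤ 1 / q ^ 2 := by
    apply Finset.exists_le_of_sum_le
    · rw [Finset.nonempty_range_iff]
      have : 0 < S := by exact_mod_cast hS0
      omega
    · refine (energy f hf).trans ?_
      rw [Finset.sum_const, Finset.card_range, nsmul_eq_mul, hS']
      have : (q : ℝ) ^ 2 * n * (1 / q ^ 2) = n := by field_simp
      rw [this]; linarith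
  rw [Finset.mem_range] at hs₀
  set g := (stepOp θ p ^ s₀) f with hg
  have hgb : ∀ ε j, |g ε j| ≤ 1 := stepOp_pow_bound h h0 (by linarith) hf s₀
  have hgm : mean n p g = 0 := by rw [hg, mean_stepOp_pow h, hm]
  have hmo : mean n p |oddObs g| ≤ 1 / q := by
    have h2 := (sq_mean_abs_oddObs_le h g).trans hodd
    rw [← one_div_pow] at h2
    exact le_of_sq_le_sq h2 (by positivity)
  -- Self-adjointness of the flip times `P^s`, with each flip replaced by the identity up to an odd
  -- part.
  have term : ∀ s, s < S → mean n p (((stepOp θ p ^ S) g) ^ 2) ≤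
      mean n p (g * (stepOp θ p ^ (s + s)) g) + 2 * oddSq n p ((stepOp θ p ^ s) g) + 2 / q := by
    intro s hs
    refine (mean_sq_stepOp_pow_anti h h0 h1 g hs.le).trans ?_
    have e1 := mean_stepOp_pow_mul_lazyFlip h θ s ((stepOp θ p ^ s) g) g
    rw [← Module.End.mul_apply, ← pow_add, mean_lazyFlip_mul_eq, mean_lazyFlip_mul,
      mean_lazyFlip_mul_eq, mean_mul_oddObs, ← sq] at e1
    have h3 := abs_mean_mul_le h (u := (stepOp θ p ^ (s + s)) g) (v := oddObs g) (B := 1)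
      fun ε j _ _ => stepOp_pow_bound h h0 (by linarith) hgb _ ε j
    have h4 := (abs_le.1 (h3.trans ((one_mul _).le.trans hmo))).1
    have h5 := oddSq_nonneg h ((stepOp θ p ^ s) g)
    rw [mul_comm g]
    have h6 : (2 : ℝ) / q = 2 * (1 / q) := by ring
    have h8 : (0 : ℝ) ≤ 1 / q := by positivity
    have h9 := mul_le_mul_of_nonneg_left h4 (by linarith : 0 ≤ 2 * (1 - θ))
    have h10 : 0 ≤ θ * (1 / q) := by positivity
    have h11 : 0 ≤ θ * oddSq n p ((stepOp θ p ^ s) g) := by positivity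
    linarith
  have hsum : S * mean n p (((stepOp θ p ^ S) g) ^ 2) ≤
      mean n p (g * (∑ s ∈ Finset.range S, stepOp θ p ^ (s + s)) g) + 2 * (n / 2) +
        S * (2 / q) := by
    have h2 := Finset.sum_le_sum (s := Finset.range S) fun s hs => term s (Finset.mem_range.1 hs)
    rw [Finset.sum_const, Finset.card_range, nsmul_eq_mul, Finset.sum_add_distrib,
      Finset.sum_add_distrib, Finset.sum_const, Finset.card_range, nsmul_eq_mul,
      ← Finset.mul_sum, ← map_sum, ← Finset.mul_sum, ← LinearMap.sum_apply] at h2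
    have := energy g hgb
    linarith
  have hT := congrArg (fun T : Module.End ℝ Obs => T g) (sum_pow_add_sum_neg_pow (stepOp θ p) S)
  have h2 := abs_mean_mul_le h (u := (∑ s ∈ Finset.range (2 * S), stepOp θ p ^ s) g) (v := g)
    (B := 52 * n) fun ε j hj hj' => by
      rw [LinearMap.sum_apply]
      exact abs_sum_pow_le h h0 h1 hθ.le hgb hgm (2 * S) ε hj hj'
  have h3 := abs_mean_mul_le h (u := g) (B := 1)
    (v := (∑ s ∈ Finset.range (2 * S), (-stepOp θ p) ^ s) g) fun ε j _ _ => hgb ε j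
  have h4 := mean_abs_sum_neg_pow_le h h0 h1 hθ hgb hq
  rw [← hS] at h4
  have h5 := mean_abs_le_one h hgb
  have e2 : 2 * mean n p (g * (∑ s ∈ Finset.range S, stepOp θ p ^ (s + s)) g) =
      mean n p ((∑ s ∈ Finset.range (2 * S), stepOp θ p ^ s) g * g) +
        mean n p (g * (∑ s ∈ Finset.range (2 * S), (-stepOp θ p) ^ s) g) := by
    rw [← map_add, mul_comm _ g, ← mul_add, ← LinearMap.add_apply]
    rw [hT, LinearMap.add_apply, mul_add, map_add, two_mul]
  have h6 := (abs_le.1 h2).2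
  have h7 := (abs_le.1 h3).2
  have h8 := mul_le_mul_of_nonneg_left h5 (by positivity : (0 : ℝ) ≤ 52 * n)
  -- Half of `52 n + 8 S/q`, plus `n + 2 S/q`, is `27 n + 6 S/q`; and `n ≤ S/q`.
  have h9 : S * mean n p (((stepOp θ p ^ S) g) ^ 2) ≤ S * (33 / q) := by
    have e3 : (S : ℝ) * (33 / q) = 27 * (S * (1 / q)) + 6 * (S / q) := by ring
    have e4 : (n : ℝ) ≤ S * (1 / q) := by
      rw [hS']
      have : (q : ℝ) ^ 2 * n * (1 / q) = q * n := by field_simp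
      rw [this]; nlinarith
    have e5 : 8 * (S : ℝ) / q = 8 * (S / q) := by ring
    have e6 : (S : ℝ) * (2 / q) = 2 * (S / q) := by ring
    rw [e3]
    rw [e5] at h4
    rw [e6] at hsum
    linarith
  refine le_trans ?_ (le_of_mul_le_mul_left h9 hS0)
  rw [hg, ← Module.End.mul_apply, ← pow_add]
  exact mean_sq_stepOp_pow_anti h h0 h1 f (by omega)

end

/-! ### Resets at the mode -/

/-- The rate at which an event of probability `θ` resets the chain to the mode: `1` at the mode,
the acceptance probability at states moving away from it, `0` at states moving towards it. -/
noncomputable def resetRate (p : ℤ → ℝ) (J : ℤ) : Obs := fun ε j =>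
  if j = J then 1 else if 0 < (ε : ℤ) * (j - J) then acc p ε j else 0

/-- The potential of a state at distance `k` from the mode with `r` steps to go, for the costs `b`
of being at the mode. -/
noncomputable def potential (b : ℕ → ℝ) (r k : ℕ) : ℝ :=
  ∑ i ∈ Finset.range (r - k), b i + ∑ i ∈ Finset.range (r - k - 1), b i +
    ∑ i ∈ Finset.range r, b i

/-- The cost paid at a state with `r` steps to go. -/
noncomputable def resetCost (p : ℤ → ℝ) (J : ℤ) (b : ℕ → ℝ) (r : ℕ) : Obs := fun ε j =>
  if j = J then b r + b (r - 1)
  else if 0 < (ε : ℤ) * (j - J) then acc p ε j * b (r - (j - J).natAbs - 1) else 0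

section

variable {b : ℕ → ℝ}

theorem sum_range_mono (hb : ∀ i, 0 ≤ b i) {s t : ℕ} (h : s ≤ t) :
    ∑ i ∈ Finset.range s, b i ≤ ∑ i ∈ Finset.range t, b i :=
  Finset.sum_le_sum_of_subset_of_nonneg (Finset.range_mono h) fun i _ _ => hb i

/-- The second hypothesis says that `r - k`, the steps left after a direct run to the mode, does not
decrease. An inward move keeps this quantity fixed while `r` drops by one. -/
theorem potential_le (hb : ∀ i, 0 ≤ b i) {r r' k k' : ℕ} (hr : r ≤ r') (hk : k' + r ≤ k + r') :
    potential b r k ≤ potential b r' k' :=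
  add_le_add (add_le_add (sum_range_mono hb (by omega)) (sum_range_mono hb (by omega)))
    (sum_range_mono hb hr)

theorem potential_succ {r k : ℕ} (h : k + 1 ≤ r) :
    potential b (r + 1) k = potential b r k + b (r - k) + b (r - k - 1) + b r := by
  obtain ⟨d, rfl⟩ := Nat.exists_eq_add_of_le h
  have e1 : k + 1 + d + 1 - k = d + 1 + 1 := by omega
  have e2 : k + 1 + d - k = d + 1 := by omega
  simp only [potential, e1, e2, Nat.add_sub_cancel, Finset.sum_range_succ]
  ring

theorem potential_nonneg (hb : ∀ i, 0 ≤ b i) (r k : ℕ) : 0 ≤ potential b r k :=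
  add_nonneg (add_nonneg (Finset.sum_nonneg fun i _ => hb i) (Finset.sum_nonneg fun i _ => hb i))
    (Finset.sum_nonneg fun i _ => hb i)

theorem potential_le_three_mul (hb : ∀ i, 0 ≤ b i) (r k : ℕ) :
    potential b r k ≤ 3 * ∑ i ∈ Finset.range r, b i := by
  have := sum_range_mono hb (show r - k ≤ r by omega)
  have := sum_range_mono hb (show r - k - 1 ≤ r by omega)
  simp only [potential]
  linarith

end

section

variable {n : ℕ} {p : ℤ → ℝ} {J : ℤ}

theorem stepOp_eq (θ : ℝ) (p : ℤ → ℝ) (f : Obs) :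
    stepOp θ p f = (1 - θ) • stepOp 0 p f + θ • moveOp p f := by
  have : lazyFlip θ f = (1 - θ) • lazyFlip 0 f + θ • f := by
    ext ε j
    simp only [lazyFlip_apply, Pi.add_apply, Pi.smul_apply, smul_eq_mul]
    ring
  rw [stepOp_apply, stepOp_apply, this, map_add, map_smul, map_smul]

theorem acc_inward (h : IsProfile n p J) {ε : ℤˣ} {j : ℤ} (hj : 1 ≤ j) (hj' : j ≤ n)
    (hε : (ε : ℤ) * (j - J) < 0) : acc p ε j = 1 := by
  refine acc_eq_one (h.pos j hj hj') ?_
  rcases Int.units_eq_one_or ε with rfl | rfl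
  · exact h.le_succ j (by simp at hε; omega)
  · have := h.succ_le (j - 1) (by simp at hε; omega)
    simpa [sub_eq_add_neg] using this

theorem acc_pos_mem (h : IsProfile n p J) {ε : ℤˣ} {j : ℤ} (ha : acc p ε j ≠ 0) :
    (1 ≤ j ∧ j ≤ n) ∧ 1 ≤ j + ε ∧ j + ε ≤ n := by
  constructor
  · exact h.mem_of_ne_zero fun h0 => ha (acc_eq_zero (Or.inl h0))
  · exact h.mem_of_ne_zero fun h0 => ha (acc_eq_zero (Or.inr h0))

theorem stepOp_pow_nonneg (h : IsProfile n p J) {θ : ℝ} (h0 : 0 ≤ θ) (h1 : θ ≤ 1) {D : Obs}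
    (hD : 0 ≤ D) (s : ℕ) : 0 ≤ (stepOp θ p ^ s) D := by
  simpa using stepOp_pow_mono h h0 h1 hD s

/-- Moving towards the mode is deterministic up to events of probability `θ`. -/
theorem inward_le (h : IsProfile n p J) {θ : ℝ} (h0 : 0 ≤ θ) (h1 : θ ≤ 1) {D : Obs}
    (hD : 0 ≤ D) (ε : ℤˣ) (r : ℕ) {d : ℕ} (hd : 1 ≤ J + ε * d) (hd' : J + ε * d ≤ n) :
    (1 - θ) ^ d * (stepOp θ p ^ r) D (-ε) J ≤
      (stepOp θ p ^ (r + d)) D (-ε) (J + ε * d) := by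
  have hJ := h.one_le
  have hJ' := h.le_size
  induction d with
  | zero => simp
  | succ d ih =>
    have ih := ih
      (by rcases Int.units_eq_one_or ε with rfl | rfl <;> push_cast at * <;> omega)
      (by rcases Int.units_eq_one_or ε with rfl | rfl <;> push_cast at * <;> omega)
    have ha : acc p (-ε) (J + ε * (d + 1 : ℕ)) = 1 := by
      refine acc_inward h hd hd' ?_
      have : (ε : ℤ) * ε = 1 := by exact_mod_cast Int.units_coe_mul_self ε
      rw [Units.val_neg, add_sub_cancel_left, ← mul_assoc, neg_mul, this]
      push_cast; omega
    have e : J + (ε : ℤ) * (d + 1 : ℕ) + (-ε : ℤˣ) = J + ε * d := by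
      rw [Units.val_neg]; push_cast; ring
    rw [← add_assoc, pow_succ' (stepOp θ p), Module.End.mul_apply, stepOp_apply, moveOp_apply, ha,
      e, lazyFlip_apply, lazyFlip_apply, neg_neg]
    have h3 := mul_le_mul_of_nonneg_left ih (sub_nonneg.2 h1)
    have h4 := mul_nonneg h0 (stepOp_pow_nonneg h h0 h1 hD (r + d) ε (J + ε * d))
    rw [pow_succ']
    linarith

theorem mul_one_sub_le {D κ b : ℝ} (hD : 0 ≤ D) (hb : 1 - b ≤ D) (hκ : 0 ≤ κ) (hκ' : κ ≤ 1) :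
    κ * (1 - b) ≤ D :=
  (mul_le_mul_of_nonneg_left hb hκ).trans (mul_le_of_le_one_left hD hκ')

/-- An event of probability `θ` brings the chain to the mode at a predictable time. -/
theorem resetRate_sub_cost_le (h : IsProfile n p J) {θ : ℝ} (h0 : 0 ≤ θ) (h1 : θ ≤ 1) {D : Obs}
    (hD : 0 ≤ D) {b : ℕ → ℝ} (hb0 : ∀ r, 0 ≤ b r)
    (hb : ∀ r ε, 1 - b r ≤ (stepOp θ p ^ r) D ε J) {r : ℕ}
    (hr : n ≤ r) (ε : ℤˣ) (j : ℤ) :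
    (1 - θ) ^ n * (resetRate p J ε j - resetCost p J b r ε j) ≤
      moveOp p ((stepOp θ p ^ r) D) ε j := by
  set κ := (1 - θ) ^ n with hκ
  have hκ0 : 0 ≤ κ := pow_nonneg (sub_nonneg.2 h1) n
  have hκ1 : κ ≤ 1 := pow_le_one₀ (sub_nonneg.2 h1) (by linarith)
  have hDr := fun r => stepOp_pow_nonneg h h0 h1 hD r
  -- After an accepted outward move without flip the state points inward at distance `k + 1`, so it
  -- is at the mode with `r - k - 1` steps left, unless a further event of probability `θ` occurs.
  have out : ∀ k : ℕ, acc p ε (J + ε * k) * (κ * (1 - b (r - k - 1))) ≤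
      acc p ε (J + ε * k) * (stepOp θ p ^ r) D (-ε) (J + ε * k + ε) := by
    intro k
    by_cases ha : acc p ε (J + ε * k) = 0
    · rw [ha, zero_mul, zero_mul]
    refine mul_le_mul_of_nonneg_left ?_ (acc_nonneg h _ _)
    obtain ⟨-, h3, h4⟩ := acc_pos_mem h ha
    have hJ := h.one_le
    have hJ' := h.le_size
    have hk : k + 1 ≤ n := by rcases Int.units_eq_one_or ε with rfl | rfl <;> simp at h3 h4 <;> omega
    have e : J + (ε : ℤ) * k + ε = J + ε * (k + 1 : ℕ) := by push_cast; ring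
    rw [e] at h3 h4 ⊢
    have h5 := inward_le h h0 h1 hD ε (r - k - 1) h3 h4
    rw [show r - k - 1 + (k + 1) = r by omega] at h5
    refine le_trans ?_ h5
    have h6 : κ ≤ (1 - θ) ^ (k + 1) :=
      pow_le_pow_of_le_one (sub_nonneg.2 h1) (by linarith) hk
    have h7 := hDr (r - k - 1) (-ε) J
    rw [Pi.zero_apply, Pi.zero_apply] at h7
    exact (mul_le_mul_of_nonneg_left (hb _ _) hκ0).trans (mul_le_mul_of_nonneg_right h6 h7)
  have hstay : 0 ≤ (1 - acc p ε j) * (stepOp θ p ^ r) D ε j :=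
    mul_nonneg (sub_nonneg.2 (acc_le_one p ε j)) (hDr r ε j)
  have hmove : 0 ≤ acc p ε j * (stepOp θ p ^ r) D (-ε) (j + ε) :=
    mul_nonneg (acc_nonneg h ε j) (hDr r _ _)
  rw [moveOp_apply]
  by_cases hj : j = J
  · subst hj
    simp only [resetRate, resetCost, if_true]
    have h2 := out 0
    simp only [Nat.cast_zero, mul_zero, add_zero, Nat.sub_zero] at h2
    have ha0 := acc_nonneg h ε j
    have ha1 := sub_nonneg.2 (acc_le_one p ε j)
    have h3 := mul_le_mul_of_nonneg_left (mul_one_sub_le (hDr r ε j) (hb r ε) hκ0 hκ1) ha1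
    have h4 := mul_nonneg (mul_nonneg hκ0 ha0) (hb0 r)
    have h5 := mul_nonneg (mul_nonneg hκ0 ha1) (hb0 (r - 1))
    linarith
  · by_cases hout : 0 < (ε : ℤ) * (j - J)
    · simp only [resetRate, resetCost, if_neg hj, if_pos hout]
      have e : J + (ε : ℤ) * (j - J).natAbs = j := by
        rcases Int.units_eq_one_or ε with rfl | rfl <;> simp at hout <;>
          simp only [Units.val_neg, Units.val_one, neg_mul, one_mul] <;> omega
      have h2 := out (j - J).natAbs
      rw [e] at h2
      linarith
    · simp only [resetRate, resetCost, if_neg hj, if_neg hout, sub_zero, mul_zero]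
      linarith

/-- The potential prepays all costs met by the chain with `θ = 0`. An accepted outward step lowers
`r - k` by two and a rejected one by one, and the terms released cover the cost; the third sum in
the potential pays for `b r` at the mode. -/
theorem potential_drift (h : IsProfile n p J) {b : ℕ → ℝ} (hb : ∀ i, 0 ≤ b i) {r : ℕ}
    (hr : n ≤ r) (ε : ℤˣ) (j : ℤ) :
    stepOp 0 p (fun _ j => potential b r (j - J).natAbs) ε j + resetCost p J b r ε j ≤
      potential b (r + 1) (j - J).natAbs := by
  have e : stepOp 0 p (fun _ j => potential b r (j - J).natAbs) ε j =
      (1 - acc p ε j) * potential b r (j - J).natAbs +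
        acc p ε j * potential b r (j + ε - J).natAbs := by
    rw [stepOp_apply, moveOp_apply]
    simp only [lazyFlip_apply]
    ring
  rw [e]
  have ha0 := acc_nonneg h ε j
  have ha1 := sub_nonneg.2 (acc_le_one p ε j)
  have hJ := h.one_le
  have hJ' := h.le_size
  have hmono : potential b r (j - J).natAbs ≤ potential b (r + 1) (j - J).natAbs :=
    potential_le hb (by omega) (by omega)
  -- The case without cost: it absorbs everything off the interval and the blocked moves at its
  -- ends.
  by_cases ha : acc p ε j = 0 ∧ j ≠ J
  · have hc : resetCost p J b r ε j = 0 := by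
      simp only [resetCost, if_neg ha.2, ha.1, zero_mul, ite_self]
    rw [hc, ha.1]
    linarith
  have hmem : 1 ≤ j ∧ j ≤ n := by
    by_cases hj : j = J
    · omega
    · exact (acc_pos_mem h fun h0 => ha ⟨h0, hj⟩).1
  by_cases hin : (ε : ℤ) * (j - J) < 0
  · have hne : j ≠ J := by rintro rfl; simp at hin
    rw [acc_inward h hmem.1 hmem.2 hin]
    simp only [resetCost, if_neg hne, if_neg hin.le.not_gt]
    have : potential b r (j + ε - J).natAbs ≤ potential b (r + 1) (j - J).natAbs := by
      refine potential_le hb (by omega) ?_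
      rcases Int.units_eq_one_or ε with rfl | rfl <;> simp at hin ⊢ <;> omega
    linarith
  · have h3 : potential b r (j + ε - J).natAbs ≤ potential b r (j - J).natAbs := by
      refine potential_le hb le_rfl ?_
      rcases Int.units_eq_one_or ε with rfl | rfl <;> simp at hin ⊢ <;> omega
    have h4 := mul_le_mul_of_nonneg_left h3 ha0
    have h5 := potential_succ (b := b) (show (j - J).natAbs + 1 ≤ r by omega)
    have h6 : resetCost p J b r ε j ≤
        b (r - (j - J).natAbs) + b (r - (j - J).natAbs - 1) + b r := by
      have := hb (r - (j - J).natAbs)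
      have := hb r
      have h8 := hb (r - (j - J).natAbs - 1)
      by_cases hj : j = J
      · subst hj
        simp only [resetCost, if_true, sub_self, Int.natAbs_zero, Nat.sub_zero]
        linarith
      · simp only [resetCost, if_neg hj]
        split_ifs
        · have := mul_le_of_le_one_left h8 (acc_le_one p ε j)
          linarith
        · linarith
    linarith

theorem resetRate_nonneg (h : IsProfile n p J) (ε : ℤˣ) (j : ℤ) : 0 ≤ resetRate p J ε j := by
  unfold resetRate
  split_ifs
  exacts [zero_le_one, acc_nonneg h ε j, le_rfl]

theorem resetRate_le_one (p : ℤ → ℝ) (J : ℤ) (ε : ℤˣ) (j : ℤ) : resetRate p J ε j ≤ 1 := by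
  unfold resetRate
  split_ifs
  exacts [le_rfl, acc_le_one p ε j, zero_le_one]

/-- Iterates `stepOp_eq`: the part without an omitted flip transports the previous bound by the `θ =
0` chain, and the part of weight `θ` contributes a reset. The initial `n` steps are held back so
that each reset has time to reach the mode. -/
theorem reset_lower_bound (h : IsProfile n p J) {θ : ℝ} (h0 : 0 ≤ θ) (h1 : θ ≤ 1) {D : Obs}
    (hD : 0 ≤ D) {b : ℕ → ℝ} (hb0 : ∀ r, 0 ≤ b r)
    (hb : ∀ r ε, 1 - b r ≤ (stepOp θ p ^ r) D ε J) (s : ℕ) (ε : ℤˣ) (j : ℤ) :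
    (1 - θ) ^ n * θ * ((1 - θ) ^ s *
      (∑ i ∈ Finset.range s, (stepOp 0 p ^ i) (resetRate p J)) ε j -
        potential b (n + s) (j - J).natAbs) ≤ (stepOp θ p ^ (n + s)) D ε j := by
  have hθ' : 0 ≤ 1 - θ := sub_nonneg.2 h1
  have hκ0 : 0 ≤ (1 - θ) ^ n := pow_nonneg hθ' n
  induction s generalizing ε j with
  | zero =>
    have h2 := stepOp_pow_nonneg h h0 h1 hD n ε j
    have h3 := mul_nonneg (mul_nonneg hκ0 h0) (potential_nonneg hb0 n (j - J).natAbs)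
    simp only [Finset.range_zero, Finset.sum_empty, Pi.zero_apply, add_zero, mul_zero] at h2 ⊢
    linarith
  | succ s ih =>
    set Y := ∑ i ∈ Finset.range s, (stepOp 0 p ^ i) (resetRate p J) with hY
    set V : Obs := fun _ j => potential b (n + s) (j - J).natAbs with hV
    have hsum : ∑ i ∈ Finset.range (s + 1), (stepOp 0 p ^ i) (resetRate p J) =
        stepOp 0 p Y + resetRate p J := by
      rw [Finset.sum_range_succ', hY, map_sum]
      simp only [pow_succ', Module.End.mul_apply, pow_zero, Module.End.one_apply]
    have h2 : ((1 - θ) ^ n * θ) • ((1 - θ) ^ s • Y - V) ≤ (stepOp θ p ^ (n + s)) D :=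
      fun ε j => ih ε j
    have h3 := stepOp_mono h le_rfl zero_le_one h2 ε j
    have h4 := resetRate_sub_cost_le h h0 h1 hD hb0 hb (Nat.le_add_right n s) ε j
    have h5 : stepOp 0 p V ε j + resetCost p J b (n + s) ε j ≤
        potential b (n + s + 1) (j - J).natAbs :=
      potential_drift h hb0 (Nat.le_add_right n s) ε j
    rw [map_smul, map_sub, map_smul] at h3
    simp only [Pi.smul_apply, Pi.sub_apply, smul_eq_mul] at h3
    have hV0 : 0 ≤ stepOp 0 p V ε j := by
      have := stepOp_mono h le_rfl zero_le_one
        (show (0 : Obs) ≤ V from fun _ j => potential_nonneg hb0 _ _) ε j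
      rwa [map_zero] at this
    rw [hsum, ← add_assoc, pow_succ' (stepOp θ p), Module.End.mul_apply,
      stepOp_eq θ p ((stepOp θ p ^ (n + s)) D)]
    simp only [Pi.add_apply, Pi.smul_apply, smul_eq_mul]
    have h6 := mul_le_mul_of_nonneg_left h3 hθ'
    have h7 := mul_le_mul_of_nonneg_left h4 h0
    have h8 : (1 - θ) ^ n * θ * ((1 - θ) ^ (s + 1) * resetRate p J ε j) ≤
        (1 - θ) ^ n * θ * resetRate p J ε j :=
      mul_le_mul_of_nonneg_left (mul_le_of_le_one_left (resetRate_nonneg h ε j)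
        (pow_le_one₀ hθ' (by linarith))) (mul_nonneg hκ0 h0)
    have h9 := mul_le_mul_of_nonneg_left h5 (mul_nonneg hκ0 h0)
    have h10 := mul_nonneg (mul_nonneg hκ0 h0) (mul_nonneg h0 hV0)
    have e : (1 - θ) ^ (s + 1) = (1 - θ) * (1 - θ) ^ s := pow_succ' _ _
    rw [e] at h8 ⊢
    linarith

/-- The reset rate dominates the indicator of the mode plus one move applied to the indicator of
inward states at distance at least 2. Moves preserve the mean, and the three central sites have mass
at most `3 p J`, so the mean is at least `p J` and at least `(1 - p J) / 2`. -/
theorem one_third_le_mean_resetRate (h : IsProfile n p J) :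
    1 / 3 ≤ mean n p (resetRate p J) := by
  set w : Obs := fun _ j => if j = J then 1 else 0 with hw
  set v : Obs := fun ε j => if (ε : ℤ) * (j - J) ≤ -2 then 1 else 0 with hv
  have h1 : mean n p (w + moveOp p v) ≤ mean n p (resetRate p J) := by
    refine mean_mono h fun ε j hj hj' => ?_
    have ha := fun hin => acc_inward h (ε := ε) hj hj' hin
    simp only [hw, hv, resetRate, Pi.add_apply, moveOp_apply]
    rcases Int.units_eq_one_or ε with rfl | rfl
    · simp only [Units.val_neg, Units.val_one, neg_mul, one_mul] at ha ⊢
      by_cases c1 : j = J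
      · simp [c1]
      by_cases c2 : 0 < j - J
      · rw [if_neg c1, if_neg (by omega), if_pos (by omega), if_neg c1, if_pos c2]; linarith
      · rw [if_neg c1, if_neg c1, if_neg c2, ha (by omega), if_neg (by omega : ¬ -(j + 1 - J) ≤ -2)]
        linarith
    · simp only [Units.val_neg, Units.val_one, neg_mul, one_mul, neg_neg] at ha ⊢
      by_cases c1 : j = J
      · simp [c1]
      by_cases c2 : 0 < -(j - J)
      · rw [if_neg c1, if_neg (by omega), if_pos (by omega), if_neg c1, if_pos c2]; linarith
      · rw [if_neg c1, if_neg c1, if_neg c2, ha (by omega), if_neg (by omega : ¬ j + -1 - J ≤ -2)]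
        linarith
  rw [map_add, mean_moveOp h] at h1
  have ind : ∀ a, ∑ j ∈ Finset.Icc 1 (n : ℤ), p j * (if j = a then 1 else 0) ≤ p a := by
    intro a
    simp only [mul_ite, mul_one, mul_zero, Finset.sum_ite_eq']
    split_ifs
    exacts [le_rfl, h.nonneg a]
  have h2 : mean n p w = p J := by
    rw [mean_apply]
    have : J ∈ Finset.Icc 1 (n : ℤ) := Finset.mem_Icc.2 ⟨h.one_le, h.le_size⟩
    rw [Finset.sum_eq_single_of_mem J this]
    · simp [hw]
    · intro j _ hj; simp [hw, hj]
  have h3 : (1 - 3 * p J) / 2 ≤ mean n p v := by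
    have e : mean n p v = (∑ j ∈ Finset.Icc 1 (n : ℤ), p j -
        ∑ j ∈ Finset.Icc 1 (n : ℤ), p j * (if j = J then 1 else 0) -
        ∑ j ∈ Finset.Icc 1 (n : ℤ), p j * (if j = J + 1 then 1 else 0) -
        ∑ j ∈ Finset.Icc 1 (n : ℤ), p j * (if j = J - 1 then 1 else 0)) / 2 := by
      rw [mean_apply, ← Finset.sum_sub_distrib, ← Finset.sum_sub_distrib,
        ← Finset.sum_sub_distrib, Finset.sum_div]
      refine Finset.sum_congr rfl fun j _ => ?_
      simp only [hv, Units.val_neg, Units.val_one, neg_mul, one_mul]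
      split_ifs <;> first | omega | ring
    rw [e, h.sum_eq_one]
    have := ind J
    have := ind (J + 1)
    have := ind (J - 1)
    have := h.succ_le J le_rfl
    have h4 := h.le_succ (J - 1) (by omega)
    rw [sub_add_cancel] at h4
    linarith
  have h4 : 0 ≤ mean n p v := by
    have := mean_mono h (f := 0) (g := v) fun ε j _ _ => by
      simp only [hv, Pi.zero_apply]; split_ifs <;> norm_num
    rwa [map_zero] at this
  linarith

theorem exp_neg_two_le_pow {θ : ℝ} (h0 : 0 ≤ θ) (h1 : θ ≤ 1 / 2) (hθ : θ * n = 1) :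
    Real.exp (-2) ≤ (1 - θ) ^ n := by
  have h2 : Real.exp (-(2 * θ)) ≤ 1 - θ := by
    rw [Real.exp_neg, inv_le_comm₀ (Real.exp_pos _) (by linarith)]
    refine le_trans ?_ (Real.add_one_le_exp _)
    rw [inv_le_iff_one_le_mul₀ (by linarith)]
    nlinarith
  calc Real.exp (-2) = Real.exp (-(2 * θ)) ^ n := by
        rw [← Real.exp_nat_mul]; congr 1; linear_combination 2 * hθ
    _ ≤ _ := pow_le_pow_left₀ (Real.exp_pos _).le h2 n

/-- If a function is small on average at the mode, then its supremum has decreased. -/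
theorem stepOp_pow_le_of_sum_le (h : IsProfile n p J) {θ : ℝ} (h0 : 0 ≤ θ) (h1 : θ ≤ 1 / 2)
    (hθ : θ * n = 1) {f : Obs} (hf : ∀ ε j, |f ε j| ≤ 1)
    (hs : θ * ∑ i ∈ Finset.range (313 * n),
      (|(stepOp θ p ^ i) f 1 J| + |(stepOp θ p ^ i) f (-1) J|) ≤ Real.exp (-2) ^ 312)
    (ε : ℤˣ) {j : ℤ} (hj : 1 ≤ j) (hj' : j ≤ n) :
    (stepOp θ p ^ (313 * n)) f ε j ≤ 1 - Real.exp (-2) ^ 313 := by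
  set b : ℕ → ℝ := fun i => |(stepOp θ p ^ i) f 1 J| + |(stepOp θ p ^ i) f (-1) J| with hb
  have hb0 : ∀ r, 0 ≤ b r := fun r => by simp only [hb]; positivity
  have hDr : ∀ r, (stepOp θ p ^ r) (1 - f) = 1 - (stepOp θ p ^ r) f := by
    intro r
    rw [map_sub]
    congr 1
    exact stepOp_pow_const θ p 1 r
  have hD : (0 : Obs) ≤ 1 - f := fun ε j => by
    have := (abs_le.1 (hf ε j)).2
    simp only [Pi.zero_apply, Pi.sub_apply, Pi.one_apply]; linarith
  have hb1 : ∀ r ε, 1 - b r ≤ (stepOp θ p ^ r) (1 - f) ε J := by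
    intro r ε
    rw [hDr]
    simp only [hb, Pi.sub_apply, Pi.one_apply]
    have h2 := le_abs_self ((stepOp θ p ^ r) f 1 J)
    have h3 := le_abs_self ((stepOp θ p ^ r) f (-1) J)
    have := abs_nonneg ((stepOp θ p ^ r) f 1 J)
    have := abs_nonneg ((stepOp θ p ^ r) f (-1) J)
    rcases Int.units_eq_one_or ε with rfl | rfl <;> linarith
  have key := reset_lower_bound h h0 (by linarith) hD hb0 hb1 (312 * n) ε j
  rw [show n + 312 * n = 313 * n by ring, hDr] at key
  set Y := (∑ i ∈ Finset.range (312 * n), (stepOp 0 p ^ i) (resetRate p J)) ε j with hY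
  set m := mean n p (resetRate p J) with hm
  have hm3 : 1 / 3 ≤ m := one_third_le_mean_resetRate h
  -- Time averaging for the chain with `θ = 0`, whose Poisson bound holds as well: `312 / 3 - 52 =
  -- 52`.
  have hYn : 52 * (n : ℝ) ≤ Y := by
    have h2 := abs_sum_pow_sub_le h le_rfl (by norm_num) (by norm_num)
      (fun ε j => resetRate_nonneg h ε j) (fun ε j => resetRate_le_one p J ε j) (312 * n) ε hj hj'
    have h3 := (abs_le.1 h2).1
    rw [← hY, ← hm] at h3
    push_cast at h3
    have h4 := mul_le_mul_of_nonneg_left hm3 (by positivity : (0 : ℝ) ≤ 312 * n)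
    linarith
  have hκ := exp_neg_two_le_pow h0 h1 hθ
  set E := Real.exp (-2) with hE
  have hE0 : 0 < E := Real.exp_pos _
  have h2 : E ^ 312 ≤ (1 - θ) ^ (312 * n) := by
    rw [mul_comm, pow_mul]
    exact pow_le_pow_left₀ hE0.le hκ 312
  have h3 := mul_le_mul_of_nonneg_left (potential_le_three_mul hb0 (313 * n) (j - J).natAbs) h0
  have h4 : 52 ≤ θ * Y := by
    have := mul_le_mul_of_nonneg_left hYn h0
    have : θ * (52 * n) = 52 := by linear_combination 52 * hθ
    linarith
  have h5 : E ^ 312 * 52 ≤ (1 - θ) ^ (312 * n) * (θ * Y) :=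
    mul_le_mul h2 h4 (by norm_num) (pow_nonneg (by linarith) _)
  -- The potential costs at most `3 E ^ 312` of the gain `52 E ^ 312`.
  have h6 : E ^ 312 ≤ θ * ((1 - θ) ^ (312 * n) * Y - potential b (313 * n) (j - J).natAbs) := by
    have : 0 < E ^ 312 := pow_pos hE0 312
    linarith
  have h7 : E ^ 313 ≤ 1 - (stepOp θ p ^ (313 * n)) f ε j := by
    refine le_trans ?_ key
    rw [mul_assoc, pow_succ' E 312]
    exact mul_le_mul hκ h6 (by positivity) (pow_nonneg (by linarith) _)
  linarith

end

/-! ### Contraction in the sup norm -/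

theorem exists_block_le {b : ℕ → ℝ} {R T : ℕ} (hR : 0 < R) {B : ℝ}
    (h : ∑ i ∈ Finset.range (R * T), b i ≤ R * B) :
    ∃ l < R, ∑ i ∈ Finset.range T, b (l * T + i) ≤ B := by
  have split : ∀ R : ℕ, ∑ i ∈ Finset.range (R * T), b i =
      ∑ l ∈ Finset.range R, ∑ i ∈ Finset.range T, b (l * T + i) := by
    intro R
    induction R with
    | zero => simp
    | succ R ih => rw [add_mul, one_mul, Finset.sum_range_add, ih, Finset.sum_range_succ]
  obtain ⟨l, hl, hle⟩ := Finset.exists_le_of_sum_le (s := Finset.range R)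
    (f := fun l => ∑ i ∈ Finset.range T, b (l * T + i)) (g := fun _ => B)
    (Finset.nonempty_range_iff.2 hR.ne') (by rw [← split]; simpa using h)
  exact ⟨l, Finset.mem_range.1 hl, hle⟩

/-- A function vanishes off the sites `1, …, n`. -/
def SuppOn (n : ℕ) (f : Obs) : Prop := ∀ ε (j : ℤ), ¬ (1 ≤ j ∧ j ≤ n) → f ε j = 0

section

variable {n : ℕ} {p : ℤ → ℝ} {J : ℤ}

theorem SuppOn.stepOp (h : IsProfile n p J) (θ : ℝ) {f : Obs} (hf : SuppOn n f) :
    SuppOn n (stepOp θ p f) := by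
  intro ε j hj
  have ha : acc p ε j = 0 := by
    by_contra ha
    exact hj (acc_pos_mem h ha).1
  rw [stepOp_apply, moveOp_apply, ha, zero_mul, add_zero, lazyFlip_apply, hf _ _ hj, hf _ _ hj]
  ring

theorem SuppOn.stepOp_pow (h : IsProfile n p J) (θ : ℝ) {f : Obs} (hf : SuppOn n f) (s : ℕ) :
    SuppOn n ((DHN.stepOp θ p ^ s) f) := by
  induction s with
  | zero => exact hf
  | succ s ih => rw [pow_succ', Module.End.mul_apply]; exact ih.stepOp h θ

theorem SuppOn.abs_le {f : Obs} (hf : SuppOn n f) {B : ℝ} (hB : 0 ≤ B)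
    (h : ∀ ε (j : ℤ), 1 ≤ j → j ≤ n → |f ε j| ≤ B) (ε : ℤˣ) (j : ℤ) : |f ε j| ≤ B := by
  by_cases hj : 1 ≤ j ∧ j ≤ n
  · exact h ε j hj.1 hj.2
  · rwa [hf ε j hj, abs_zero]

end

/-- Centred functions contract uniformly within order `n` steps. -/
theorem exists_sup_contraction : ∃ (w : ℕ) (δ : ℝ), 0 < w ∧ 0 < δ ∧ δ < 1 ∧
    ∀ {n : ℕ} {p : ℤ → ℝ} {J : ℤ} {θ : ℝ}, IsProfile n p J → 0 ≤ θ → θ ≤ 1 / 2 → θ * n = 1 →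
      ∀ f : Obs, SuppOn n f → (∀ ε j, |f ε j| ≤ 1) → mean n p f = 0 →
        ∀ ε j, |(stepOp θ p ^ (w * n)) f ε j| ≤ 1 - δ := by
  set E := Real.exp (-2) with hE
  have hE0 : 0 < E := Real.exp_pos _
  have hE1 : E < 1 := Real.exp_lt_one_iff.2 (by norm_num)
  set m := E ^ 312 with hm
  have hm0 : 0 < m := pow_pos hE0 312
  -- With `a` the mean of `|g|`, the averaged costs at the mode total at most `626 R a + 104` over
  -- `R` blocks. The choice of `q` makes `a ≤ m / 1252` and that of `R` makes `104 < R m / 2`, so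
  -- some block has cost at most `m`.
  obtain ⟨R, hR⟩ := exists_nat_gt (208 / m)
  obtain ⟨q, hq⟩ := exists_nat_gt (33 / (m / 1252) ^ 2)
  have hR0 : 0 < R := by
    have : (0 : ℝ) < R := lt_trans (by positivity) hR
    exact_mod_cast this
  have hq0 : (0 : ℝ) < q := lt_trans (by positivity) hq
  refine ⟨2 * q ^ 2 + 313 * R, E ^ 313, by omega, pow_pos hE0 _,
    pow_lt_one₀ hE0.le hE1 (by norm_num), ?_⟩
  intro n p J θ h h0 h1 hθ f hfs hf hmean
  have hn := h.one_le_size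
  set g := (stepOp θ p ^ (2 * (q ^ 2 * n))) f with hg
  have hgb : ∀ ε j, |g ε j| ≤ 1 := stepOp_pow_bound h h0 (by linarith) hf _
  set a := mean n p |g| with ha
  have ha1 : a ≤ m / 1252 := by
    have h2 := sq_mean_le h |g|
    rw [show |g| ^ 2 = g ^ 2 by ext ε j; exact sq_abs (g ε j)] at h2
    have h3 := mean_sq_decay h h0 h1 hθ hf hmean (q := q) (by exact_mod_cast hq0)
    have h4 : 33 / (q : ℝ) ≤ (m / 1252) ^ 2 := by
      rw [div_lt_iff₀ (by positivity)] at hq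
      rw [div_le_iff₀ hq0]
      linarith
    exact le_of_sq_le_sq ((h2.trans h3).trans h4) (by positivity)
  set b : ℕ → ℝ := fun i => |(stepOp θ p ^ i) g 1 J| + |(stepOp θ p ^ i) g (-1) J| with hb
  -- Time averages of the nonnegative function `|g|`, whose mean `a` is already small, dominate
  -- those of the absolute values along the orbit.
  have hone : ∀ (L : ℕ) ε, ∑ i ∈ Finset.range L, |(stepOp θ p ^ i) g ε J| ≤ L * a + 52 * n := by
    intro L ε
    have h2 := (abs_le.1 (abs_sum_pow_sub_le h h0 h1 hθ.le (abs_nonneg g)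
      (fun ε j => hgb ε j) L ε h.one_le h.le_size)).2
    rw [Finset.sum_apply, Finset.sum_apply] at h2
    have h3 := Finset.sum_le_sum (s := Finset.range L) fun i _ =>
      stepOp_pow_abs_le h h0 (by linarith) g i ε J
    simp only [Pi.abs_apply] at h3
    linarith
  obtain ⟨l, hl, hle⟩ := exists_block_le (b := fun i => θ * b i) (T := 313 * n) (B := m) hR0 (by
    rw [← Finset.mul_sum]
    simp only [hb, Finset.sum_add_distrib]
    have h2 := add_le_add (hone (R * (313 * n)) 1) (hone (R * (313 * n)) (-1))
    have h3 := mul_le_mul_of_nonneg_left h2 h0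
    refine h3.trans ?_
    push_cast
    have e : θ * (R * (313 * n) * a + 52 * n + (R * (313 * n) * a + 52 * n)) =
        626 * (R * a) + 104 := by linear_combination (626 * R * a + 104) * hθ
    rw [e]
    have h4 := mul_le_mul_of_nonneg_left ha1 (Nat.cast_nonneg R : (0 : ℝ) ≤ R)
    rw [div_lt_iff₀ hm0] at hR
    linarith)
  set f₀ := (stepOp θ p ^ (l * (313 * n))) g with hf₀
  have hf₀b : ∀ ε j, |f₀ ε j| ≤ 1 := stepOp_pow_bound h h0 (by linarith) hgb _
  have hle' : θ * ∑ i ∈ Finset.range (313 * n),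
      (|(stepOp θ p ^ i) f₀ 1 J| + |(stepOp θ p ^ i) f₀ (-1) J|) ≤ m := by
    rw [Finset.mul_sum]
    refine le_trans (le_of_eq (Finset.sum_congr rfl fun i _ => ?_)) hle
    simp only [hb, hf₀]
    rw [← Module.End.mul_apply, ← pow_add, add_comm i]
  have hlast : ∀ ε (j : ℤ), 1 ≤ j → j ≤ n →
      |(stepOp θ p ^ (313 * n)) f₀ ε j| ≤ 1 - E ^ 313 := by
    intro ε j hj hj'
    rw [abs_le']
    refine ⟨stepOp_pow_le_of_sum_le h h0 h1 hθ hf₀b hle' ε hj hj', ?_⟩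
    -- The cost at the mode involves only absolute values, so the same block serves for the lower
    -- bound.
    have := stepOp_pow_le_of_sum_le h h0 h1 hθ (f := -f₀) (by simpa using hf₀b)
      (by simpa using hle') ε hj hj'
    simpa using this
  have hs : SuppOn n ((stepOp θ p ^ (313 * n)) f₀) :=
    (((hfs.stepOp_pow h θ _).stepOp_pow h θ _).stepOp_pow h θ _)
  have hE313 : E ^ 313 ≤ 1 := pow_le_one₀ hE0.le hE1.le
  have hall := hs.abs_le (by linarith) hlast
  obtain ⟨k, hk⟩ := Nat.exists_eq_add_of_le (show l + 1 ≤ R from hl)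
  have e : (2 * q ^ 2 + 313 * R) * n =
      k * (313 * n) + (313 * n + (l * (313 * n) + 2 * (q ^ 2 * n))) := by
    rw [hk]; ring
  intro ε j
  rw [e, pow_add, Module.End.mul_apply, pow_add, Module.End.mul_apply, pow_add,
    Module.End.mul_apply]
  exact stepOp_pow_bound h h0 (by linarith) hall _ ε j

/-- Centred functions decay geometrically on the time scale `n`. -/
theorem exists_sup_decay : ∃ (w : ℕ) (δ : ℝ), 0 < w ∧ 0 < δ ∧ δ < 1 ∧
    ∀ {n : ℕ} {p : ℤ → ℝ} {J : ℤ} {θ : ℝ}, IsProfile n p J → 0 ≤ θ → θ ≤ 1 / 2 → θ * n = 1 →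
      ∀ f : Obs, SuppOn n f → mean n p f = 0 → ∀ B, 0 < B → (∀ ε j, |f ε j| ≤ B) →
        ∀ k z : ℕ, k * (w * n) ≤ z → ∀ ε j, |(stepOp θ p ^ z) f ε j| ≤ B * (1 - δ) ^ k := by
  obtain ⟨w, δ, hw, hδ, hδ1, key⟩ := exists_sup_contraction
  refine ⟨w, δ, hw, hδ, hδ1, ?_⟩
  intro n p J θ h h0 h1 hθ f hfs hmean B hB hf k
  induction k with
  | zero =>
    intro z _ ε j
    simpa using stepOp_pow_bound h h0 (by linarith) hf z ε j
  | succ k ih =>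
    intro z hz
    have h2 := ih (k * (w * n)) le_rfl
    have hB' : 0 < B * (1 - δ) ^ k := mul_pos hB (pow_pos (by linarith) k)
    set g := (stepOp θ p ^ (k * (w * n))) f with hg
    set r := B * (1 - δ) ^ k with hr
    have h3 := key h h0 h1 hθ (r⁻¹ • g)
      (fun ε j hj => by
        rw [Pi.smul_apply, Pi.smul_apply, hg, hfs.stepOp_pow h θ _ ε j hj, smul_zero])
      (fun ε j => by
        rw [Pi.smul_apply, Pi.smul_apply, smul_eq_mul, abs_mul, abs_of_pos (inv_pos.2 hB'),
          inv_mul_le_one₀ hB']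
        exact h2 ε j)
      (by rw [map_smul, hg, mean_stepOp_pow h, hmean, smul_zero])
    have h4 : ∀ ε j, |(stepOp θ p ^ (w * n)) g ε j| ≤ B * (1 - δ) ^ (k + 1) := by
      intro ε j
      have h5 := h3 ε j
      rw [map_smul, Pi.smul_apply, Pi.smul_apply, smul_eq_mul, abs_mul,
        abs_of_pos (inv_pos.2 hB'), inv_mul_le_iff₀ hB'] at h5
      rw [pow_succ, ← mul_assoc]
      exact h5
    obtain ⟨d, rfl⟩ := Nat.exists_eq_add_of_le hz
    intro ε j
    rw [show (k + 1) * (w * n) + d = d + (w * n + k * (w * n)) by ring, pow_add,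
      Module.End.mul_apply, pow_add, Module.End.mul_apply]
    exact stepOp_pow_bound h h0 (by linarith) h4 d ε j

/-! ### Transfer to the Markov kernel on the states -/

section

variable {n : ℕ}

theorem one_le_site (i : Fin n) : 1 ≤ site i := by simp [site]

theorem site_le (i : Fin n) : site i ≤ n := by
  have := i.2
  simp only [site]; omega

theorem site_injective : Function.Injective (site : Fin n → ℤ) := by
  intro i j hij
  simp only [site] at hij
  exact Fin.ext (by omega)

theorem exists_site_eq {j : ℤ} (h : 1 ≤ j ∧ j ≤ n) : ∃ i : Fin n, site i = j :=
  ⟨⟨(j - 1).toNat, by omega⟩, by simp only [site]; omega⟩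

@[simp]
theorem zeroExt_site (p : Fin n → ℝ) (i : Fin n) : zeroExt p (site i) = p i := by
  rw [zeroExt, dif_pos ⟨one_le_site i, site_le i⟩]
  congr 1
  ext
  simp [site]

theorem zeroExt_of_not (p : Fin n → ℝ) {j : ℤ} (h : ¬ (1 ≤ j ∧ j ≤ n)) : zeroExt p j = 0 :=
  dif_neg h

theorem sum_Icc_eq_sum_site (G : ℤ → ℝ) :
    ∑ j ∈ Finset.Icc 1 (n : ℤ), G j = ∑ i : Fin n, G (site i) := by
  symm
  refine Finset.sum_bij (fun i _ => site i) ?_ ?_ ?_ ?_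
  · intro i _; exact Finset.mem_Icc.2 ⟨one_le_site i, site_le i⟩
  · intro i _ j _ hij; exact site_injective hij
  · intro j hj
    obtain ⟨i, hi⟩ := exists_site_eq (Finset.mem_Icc.1 hj)
    exact ⟨i, Finset.mem_univ i, hi⟩
  · intro i _; rfl

/-- The extension by zero of a function on states. -/
noncomputable def extend (F : State n → ℝ) : Obs := fun ε j => zeroExt (fun i => F (ε, i)) j

@[simp]
theorem extend_site (F : State n → ℝ) (ε : ℤˣ) (i : Fin n) : extend F ε (site i) = F (ε, i) :=
  zeroExt_site _ i

theorem suppOn_extend (F : State n → ℝ) : SuppOn n (extend F) := fun _ _ hj => zeroExt_of_not _ hj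

theorem accept_eq (p : Fin n → ℝ) (ε : ℤˣ) (i : Fin n) :
    accept p (ε, i) = acc (zeroExt p) ε (site i) := by
  rw [accept, acc, zeroExt_site]

theorem signKernel_mulVec (θ : ℝ) (F : State n → ℝ) (s : State n) :
    (signKernel n θ).mulVec F s = (1 - θ) * F (-s.1, s.2) + θ * F s := by
  simp [signKernel, Matrix.mulVec, dotProduct, add_mul, Finset.sum_add_distrib, ite_mul]

theorem moveKernel_mulVec (p : Fin n → ℝ) (F : State n → ℝ) (ε : ℤˣ) (i : Fin n) :
    (moveKernel p).mulVec F (ε, i) = moveOp (zeroExt p) (extend F) ε (site i) := by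
  rw [moveOp_apply, extend_site, ← accept_eq]
  simp only [moveKernel, Matrix.mulVec, dotProduct, Matrix.of_apply, add_mul,
    Finset.sum_add_distrib, ite_mul, zero_mul, Finset.sum_ite_eq',
    Finset.mem_univ, if_true]
  have : ∑ s' : State n, (if s'.1 = -ε ∧ site s'.2 = site i + ε then accept p (ε, i) * F s'
      else 0) = accept p (ε, i) * extend F (-ε) (site i + ε) := by
    by_cases hj : 1 ≤ site i + ε ∧ site i + ε ≤ n
    · obtain ⟨i', hi'⟩ := exists_site_eq hj
      rw [← hi', extend_site, Finset.sum_eq_single_of_mem (-ε, i') (Finset.mem_univ _)]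
      · simp
      · rintro ⟨ε', k⟩ _ hne
        refine if_neg ?_
        rintro ⟨h1, h2⟩
        exact hne (Prod.ext h1 (site_injective h2))
    · rw [suppOn_extend F _ _ hj, mul_zero]
      refine Finset.sum_eq_zero fun s' _ => if_neg ?_
      rintro ⟨-, h2⟩
      rw [← h2] at hj
      exact hj ⟨one_le_site _, site_le _⟩
  rw [this]
  ring

theorem extend_signKernel_mulVec (θ : ℝ) (F : State n → ℝ) :
    extend ((signKernel n θ).mulVec F) = lazyFlip θ (extend F) := by
  ext ε j
  by_cases hj : 1 ≤ j ∧ j ≤ n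
  · obtain ⟨i, rfl⟩ := exists_site_eq hj
    rw [extend_site, signKernel_mulVec, lazyFlip_apply, extend_site, extend_site]
  · rw [lazyFlip_apply, suppOn_extend _ _ _ hj, suppOn_extend _ _ _ hj, suppOn_extend _ _ _ hj]
    ring

theorem extend_kernel_mulVec {p : Fin n → ℝ} {J : ℤ} (h : IsProfile n (zeroExt p) J) (θ : ℝ)
    (F : State n → ℝ) :
    extend ((kernel θ p).mulVec F) = stepOp θ (zeroExt p) (extend F) := by
  ext ε j
  by_cases hj : 1 ≤ j ∧ j ≤ n
  · obtain ⟨i, rfl⟩ := exists_site_eq hj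
    rw [extend_site, kernel, ← Matrix.mulVec_mulVec, moveKernel_mulVec, extend_signKernel_mulVec,
      stepOp_apply]
  · rw [suppOn_extend _ _ _ hj, (suppOn_extend F).stepOp h θ ε j hj]

theorem extend_kernel_pow_mulVec {p : Fin n → ℝ} {J : ℤ} (h : IsProfile n (zeroExt p) J) (θ : ℝ)
    (F : State n → ℝ) (z : ℕ) :
    extend ((kernel θ p ^ z).mulVec F) = (stepOp θ (zeroExt p) ^ z) (extend F) := by
  induction z with
  | zero => simp
  | succ z ih =>
    rw [pow_succ', pow_succ', ← Matrix.mulVec_mulVec, extend_kernel_mulVec h, ih,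
      Module.End.mul_apply]

theorem mean_extend (p : Fin n → ℝ) (F : State n → ℝ) :
    mean n (zeroExt p) (extend F) = ∑ s, stationary p s * F s := by
  rw [mean_apply, sum_Icc_eq_sum_site, Fintype.sum_prod_type_right]
  refine Finset.sum_congr rfl fun i _ => ?_
  have hu : (Finset.univ : Finset ℤˣ) = {1, -1} := rfl
  rw [hu, Finset.sum_pair (by decide)]
  simp only [zeroExt_site, extend_site, stationary]
  ring

theorem kernel_pow_mulVec_one {p : Fin n → ℝ} {J : ℤ} (h : IsProfile n (zeroExt p) J) (θ : ℝ)
    (z : ℕ) : (kernel θ p ^ z).mulVec 1 = 1 := by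
  have step : (kernel θ p).mulVec (1 : State n → ℝ) = 1 := by
    have h2 : (signKernel n θ).mulVec (1 : State n → ℝ) = 1 := by
      ext s; simp [signKernel_mulVec]
    ext ⟨ε, i⟩
    rw [kernel, ← Matrix.mulVec_mulVec, h2, moveKernel_mulVec, moveOp_apply, extend_site]
    -- The zero extension of the constant 1 is not constant, but a move with positive acceptance
    -- probability never leaves the interval.
    by_cases ha : acc (zeroExt p) ε (site i) = 0
    · simp [ha]
    · obtain ⟨i', hi'⟩ := exists_site_eq (acc_pos_mem h ha).2
      rw [← hi', extend_site]
      simp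
  induction z with
  | zero => simp
  | succ z ih => rw [pow_succ, ← Matrix.mulVec_mulVec, step, ih]

theorem isProfile_underlying (hn : 0 < n) {m : Fin n → ℝ} (hpos : ∀ j, 0 < m j)
    (huni : IsUnimodal m) : ∃ J, IsProfile n (zeroExt (underlying m)) J := by
  obtain ⟨c, hmono, hanti⟩ := huni
  have : Nonempty (Fin n) := ⟨⟨0, hn⟩⟩
  have hZ : 0 < ∑ i, m i := Finset.sum_pos (fun i _ => hpos i) Finset.univ_nonempty
  have hp : ∀ i, 0 < underlying m i := fun i => div_pos (hpos i) hZ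
  have hnn : ∀ j, 0 ≤ zeroExt (underlying m) j := by
    intro j
    by_cases hj : 1 ≤ j ∧ j ≤ n
    · obtain ⟨i, rfl⟩ := exists_site_eq hj
      rw [zeroExt_site]; exact (hp i).le
    · rw [zeroExt_of_not _ hj]
  refine ⟨site c, ⟨?_, ?_, ?_, ?_, one_le_site c, site_le c, ?_, ?_⟩⟩
  · intro j h1 h2
    obtain ⟨i, rfl⟩ := exists_site_eq ⟨h1, h2⟩
    rw [zeroExt_site]; exact hp i
  · intro j hj; exact zeroExt_of_not _ (by omega)
  · intro j hj; exact zeroExt_of_not _ (by omega)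
  · rw [sum_Icc_eq_sum_site]
    simp only [zeroExt_site, underlying]
    rw [← Finset.sum_div, div_self hZ.ne']
  · intro j hj
    by_cases h1 : 1 ≤ j
    · have hc := site_le c
      obtain ⟨i, rfl⟩ := exists_site_eq (n := n) ⟨h1, by omega⟩
      obtain ⟨i', hi'⟩ := exists_site_eq (n := n) (j := site i + 1) ⟨by omega, by omega⟩
      rw [← hi', zeroExt_site, zeroExt_site]
      simp only [site] at hj hi'
      refine div_le_div_of_nonneg_right (hmono ?_ ?_ ?_) hZ.le
      · rw [Set.mem_Iic, Fin.le_def]; omega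
      · rw [Set.mem_Iic, Fin.le_def]; omega
      · rw [Fin.le_def]; omega
    · rw [zeroExt_of_not _ (by omega)]; exact hnn _
  · intro j hj
    by_cases h1 : j + 1 ≤ n
    · have hc := one_le_site c
      obtain ⟨i, rfl⟩ := exists_site_eq (n := n) (j := j) ⟨by omega, by omega⟩
      obtain ⟨i', hi'⟩ := exists_site_eq (n := n) (j := site i + 1) ⟨by omega, by omega⟩
      rw [← hi', zeroExt_site, zeroExt_site]
      simp only [site] at hj hi'
      refine div_le_div_of_nonneg_right (hanti ?_ ?_ ?_) hZ.le
      · rw [Set.mem_Ici, Fin.le_def]; omega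
      · rw [Set.mem_Ici, Fin.le_def]; omega
      · rw [Fin.le_def]; omega
    · rw [zeroExt_of_not _ (by omega)]; exact hnn _

end

/-- The distance to stationarity decays geometrically on the time scale `n`, uniformly over all
unimodal probabilities. -/
theorem exists_distToStationarity_le : ∃ (w : ℕ) (δ : ℝ), 0 < w ∧ 0 < δ ∧ δ < 1 ∧
    ∀ {n : ℕ} {m : Fin n → ℝ}, 2 ≤ n → (∀ j, 0 < m j) → IsUnimodal m →
      ∀ (y : State n) (k z : ℕ), k * (w * n) ≤ z → distToStationarity m y z ≤ (1 - δ) ^ k := by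
  obtain ⟨w, δ, hw, hδ, hδ1, key⟩ := exists_sup_decay
  refine ⟨w, δ, hw, hδ, hδ1, ?_⟩
  intro n m hn hpos huni y k z hz
  obtain ⟨J, h⟩ := isProfile_underlying (by omega) hpos huni
  have hn2 : (2 : ℝ) ≤ n := by exact_mod_cast hn
  set θ : ℝ := 1 / n with hθ
  have hθ0 : 0 ≤ θ := by positivity
  have hθ1 : θ ≤ 1 / 2 := one_div_le_one_div_of_le two_pos hn2
  have hθn : θ * n = 1 := by rw [hθ]; field_simp
  set K := kernel θ (underlying m) ^ z with hK
  set x : State n → ℝ := fun s => K y s - stationary (underlying m) s with hx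
  -- The sign of the difference of the two laws realises the L¹ distance. Centring it at most
  -- doubles its size, which the factor 1/2 in the variation distance compensates.
  set φ : State n → ℝ := fun s => if 0 ≤ x s then 1 else -1 with hφ
  have hφ1 : ∀ s, |φ s| ≤ 1 := fun s => by simp only [hφ]; split_ifs <;> simp
  set c := ∑ s, stationary (underlying m) s * φ s with hc
  have hstat : ∑ s, stationary (underlying m) s = 1 := by
    have h2 := mean_extend (underlying m) 1
    simp only [Pi.one_apply, mul_one] at h2
    rw [← h2, ← mean_one h]
    refine le_antisymm (mean_mono h fun ε j hj hj' => ?_) (mean_mono h fun ε j hj hj' => ?_) <;>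
    · obtain ⟨i, rfl⟩ := exists_site_eq ⟨hj, hj'⟩
      rw [extend_site]; simp
  have hst0 : ∀ s, 0 ≤ stationary (underlying m) s := fun s => by
    have := h.nonneg (site s.2)
    rw [zeroExt_site] at this
    exact mul_nonneg (by norm_num) this
  have hc1 : |c| ≤ 1 := by
    rw [← hstat]
    refine (Finset.abs_sum_le_sum_abs _ _).trans (Finset.sum_le_sum fun s _ => ?_)
    rw [abs_mul, abs_of_nonneg (hst0 s)]
    exact mul_le_of_le_one_right (hst0 s) (hφ1 s)
  set F : State n → ℝ := φ - c • 1 with hF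
  have hFK : ∑ s, |x s| = K.mulVec F y := by
    rw [hF, Matrix.mulVec_sub, Matrix.mulVec_smul, hK, kernel_pow_mulVec_one h, ← hK]
    simp only [Pi.sub_apply, Pi.smul_apply, Pi.one_apply, smul_eq_mul, mul_one, Matrix.mulVec,
      dotProduct]
    rw [hc, ← Finset.sum_sub_distrib]
    refine Finset.sum_congr rfl fun s _ => ?_
    have : |x s| = x s * φ s := by
      simp only [hφ]
      split_ifs with h0
      · rw [abs_of_nonneg h0, mul_one]
      · rw [abs_of_neg (not_le.1 h0), mul_neg_one]
    rw [this, hx]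
    ring
  have hF2 : ∀ s, |F s| ≤ 2 := fun s => by
    have h2 := abs_sub (φ s) c
    have h3 := hφ1 s
    simp only [hF, Pi.sub_apply, Pi.smul_apply, Pi.one_apply, smul_eq_mul, mul_one]
    linarith
  have hFm : mean n (zeroExt (underlying m)) (extend F) = 0 := by
    rw [mean_extend, hF]
    simp only [Pi.sub_apply, Pi.smul_apply, Pi.one_apply, smul_eq_mul, mul_one, mul_sub,
      Finset.sum_sub_distrib]
    rw [← Finset.sum_mul, hstat, one_mul, hc, sub_self]
  have hfin := key h hθ0 hθ1 hθn (extend F) (suppOn_extend F) hFm 2 two_pos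
    ((suppOn_extend F).abs_le zero_le_two fun ε j hj hj' => by
      obtain ⟨i, rfl⟩ := exists_site_eq ⟨hj, hj'⟩
      rw [extend_site]; exact hF2 _) k z hz y.1 (site y.2)
  rw [← extend_kernel_pow_mulVec h, extend_site, ← hK] at hfin
  have h2 : distToStationarity m y z = 1 / 2 * ∑ s, |x s| := rfl
  rw [h2, hFK]
  have := le_abs_self (K.mulVec F y)
  have e : K.mulVec F (y.1, y.2) = K.mulVec F y := rfl
  rw [e] at hfin
  linarith

theorem limsupDistLE_of_forall {m : (n : ℕ) → Fin n → ℝ} {c' B B' : ℝ} (hB : B ≤ B')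
    (h : ∀ n : ℕ, 2 ≤ n → Odd n → ∀ (y : State n) (z : ℕ), c' * (n : ℝ) ≤ (z : ℝ) →
      distToStationarity (m n) y z ≤ B) : LimsupDistLE m c' B' := by
  intro ε hε
  filter_upwards [eventually_ge_atTop 2] with n hn hodd y z hz
  have := h n hn hodd y z hz
  linarith

end DHN

/-! ### The three forms of the bound -/

/-- Order `n` convergence of the Diaconis–Holmes–Neal sampler for unimodal probabilities. -/
theorem mainTheorem1 (m : (n : ℕ) → Fin n → ℝ)
    (hpos : ∀ n : ℕ, Odd n → ∀ j : Fin n, 0 < m n j)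
    (huni : ∀ n : ℕ, Odd n → IsUnimodal (m n)) :
    (∃ C : ℝ, 0 < C ∧ ∀ c : ℝ, 0 < c →
      ∃ chat : ℝ, 0 < chat ∧ chat * Real.exp (-c) < 1 ∧
        ∀ c' : ℝ, 0 < c' →
          DHN.LimsupDistLE m c' (C * (1 - chat * Real.exp (-c)) ^ ⌊c' / c⌋₊)) ∧
    (∃ c₀ chat : ℝ, 0 < c₀ ∧ 0 < chat ∧ ∀ c : ℝ, c₀ ≤ c →
      chat * Real.exp (-c) < 1 ∧
        ∀ c' : ℝ, 0 < c' →
          DHN.LimsupDistLE m c' ((1 - chat * Real.exp (-c)) ^ ⌊c' / c⌋₊)) ∧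
    (∀ δ : ℝ, 0 < δ → ∃ K : ℝ, 0 < K ∧ ∀ᶠ n : ℕ in Filter.atTop, Odd n →
      ∀ (y : DHN.State n) (z : ℕ), K * (n : ℝ) ≤ (z : ℝ) →
        DHN.distToStationarity (m n) y z < δ) := by
  obtain ⟨w, δ, hw, hδ, hδ1, key⟩ := DHN.exists_distToStationarity_le
  have hw0 : (0 : ℝ) < w := by exact_mod_cast hw
  have hρ0 : 0 < 1 - δ := by linarith
  have bound : ∀ {n : ℕ} (k : ℕ) (c' : ℝ), k * (w : ℝ) ≤ c' → 2 ≤ n → Odd n →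
      ∀ (y : DHN.State n) (z : ℕ), c' * (n : ℝ) ≤ (z : ℝ) →
        DHN.distToStationarity (m n) y z ≤ (1 - δ) ^ k := by
    intro n k c' hk hn hodd y z hz
    refine key hn (hpos n hodd) (huni n hodd) y k z ?_
    have h2 := (mul_le_mul_of_nonneg_right hk (Nat.cast_nonneg n : (0 : ℝ) ≤ n)).trans hz
    rw [mul_assoc] at h2
    exact_mod_cast h2
  refine ⟨⟨1 / (1 - δ), by positivity, fun c hc => ?_⟩, ⟨w, δ, hw0, hδ, fun c hc => ?_⟩,
    fun η hη => ?_⟩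
  -- `chat` is chosen so that the factor is exactly `(1 - δ) ^ (c / w)`; the constant `1 / (1 - δ)`
  -- absorbs the rounding of `c' / w`.
  · set q : ℝ := (1 - δ) ^ (c / w) with hq
    have hq0 : 0 < q := Real.rpow_pos_of_pos hρ0 _
    have hq1 : q < 1 := Real.rpow_lt_one hρ0.le (by linarith) (by positivity)
    have e : (1 - q) * Real.exp c * Real.exp (-c) = 1 - q := by
      rw [mul_assoc, ← Real.exp_add, add_neg_cancel, Real.exp_zero, mul_one]
    refine ⟨(1 - q) * Real.exp c, mul_pos (by linarith) (Real.exp_pos c), by rw [e]; linarith,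
      fun c' hc' => ?_⟩
    rw [e, sub_sub_cancel]
    refine DHN.limsupDistLE_of_forall ?_ fun n => bound ⌊c' / w⌋₊ c'
      ((le_div_iff₀ hw0).1 (Nat.floor_le (by positivity)))
    have h2 : (1 - δ) * (1 - δ) ^ ⌊c' / w⌋₊ ≤ q ^ ⌊c' / c⌋₊ := by
      rw [← pow_succ', hq, ← Real.rpow_natCast, ← Real.rpow_natCast, ← Real.rpow_mul hρ0.le]
      refine Real.rpow_le_rpow_of_exponent_ge hρ0 (by linarith) ?_
      have h3 := (Nat.lt_floor_add_one (c' / (w : ℝ))).le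
      have h4 := mul_le_mul_of_nonneg_left (Nat.floor_le (by positivity : 0 ≤ c' / c))
        (by positivity : 0 ≤ c / w)
      have h5 : c / w * (c' / c) = c' / w := by field_simp
      push_cast
      linarith
    rw [one_div, inv_mul_eq_div, le_div_iff₀ hρ0]
    linarith
  -- For `c ≥ w`, there are at least `⌊c' / c⌋₊` whole blocks of length `w n`, so no rounding
  -- constant is needed, and `exp (-c) ≤ 1` only weakens the factor `1 - δ`.
  · have hc0 : 0 < c := hw0.trans_le hc
    have h2 : δ * Real.exp (-c) ≤ δ :=
      mul_le_of_le_one_right hδ.le (Real.exp_le_one_iff.2 (by linarith))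
    refine ⟨by linarith, fun c' hc' => ?_⟩
    refine DHN.limsupDistLE_of_forall (pow_le_pow_left₀ hρ0.le (by linarith) ⌊c' / c⌋₊)
      fun n => bound ⌊c' / c⌋₊ c' ?_
    have h3 := (le_div_iff₀ hc0).1 (Nat.floor_le (by positivity : 0 ≤ c' / c))
    exact (mul_le_mul_of_nonneg_left hc (Nat.cast_nonneg _)).trans h3
  · obtain ⟨k, hk⟩ := exists_pow_lt_of_lt_one hη (by linarith : 1 - δ < 1)
    refine ⟨(k + 1) * w, by positivity, ?_⟩
    filter_upwards [eventually_ge_atTop 2] with n hn hodd y z hz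
    refine (bound k _ ?_ hn hodd y z hz).trans_lt hk
    linarith
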